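/- **Theorem 1.** For $u\in\mathbb R$ let $h_0(u):=\mathbf 1\{u\ge0\}$, $h_\alpha(u):=(1+u/\alpha)_+^\alpha$ for $0<\alpha<\infty$, and $h_\infty(u):=e^u$. For a real-valued random variable $X$, $\alpha\in[0,\infty]$ and $x\in\mathbb R$ put $$P_\alpha(X;x):=\inf_{\lambda\in(0,\infty)}\mathsf E\,h_\alpha\big(\lambda(X-x)\big)\in[0,\infty];$$ in particular $P_0(X;x)=\mathsf P(X\ge x)$. Let $\Lambda_X:=\{\lambda>0:\mathsf E e^{\lambda X}<\infty\}$, and write $X\in\mathcal X_\alpha$ if $\alpha=0$; or $0<\alpha<\infty$ and $\mathsf E X_+^\alpha<\infty$; or $\alpha=\infty$ and $\Lambda_X\ne\emptyset$. Let $x_*:=\sup\operatorname{supp}X\in(-\infty,\infty]$ and $p_*:=\mathsf P(X=x_*)$. Let $T_\alpha:=\mathbb R$ and $g_{\alpha;t}(u):=(u-t)_+^\alpha$ if $\alpha<\infty$ (with $0^0:=0$), and $T_\infty:=(0,\infty)$, $g_{\infty;t}(u):=e^{u/t}$. Let $\mathcal H^\alpha$ be the class of all functions $g:\mathbb R\to\mathbb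 R$ of the form $g(u)=\int_{T_\alpha}g_{\alpha;t}(u)\,\mu(dt)$ for all $u \in \mathbb R$, where $\mu$ is a nonnegative Borel measure on $T_\alpha$. Stochastic dominance of order $\alpha+1$ of $X$ by $Y$ means that $\mathsf E g(X)\le\mathsf E g(Y)$ for all $g\in\mathcal H^\alpha$. Let $\alpha\in[0,\infty]$ and let $X$ be a real-valued random variable. Then the following hold. 1. *Model-independence:* $P_\alpha(X;x)$ depends on $X$ only through the distribution of $X$. 2. *Monotonicity in $X$:* for any random variable $Y$, if $X$ is dominated by $Y$ in the sense of stochastic dominance of order $\alpha+1$, then $P_\alpha(X;x)\le P_\alpha(Y;x)$ for all $x$. The same conclusion holds under stochastic dominance of any order $\gamma\in[1,\alpha+1]$; in particular, it holds if $X\le Y$ almost surely. 3. *Monotonicity in $\alpha$:* $P_\gamma(X;x)$ is nondecreasing in $\gamma\in[0,\infty]$. 4. *Monotonicity in $x$:* $P_\alpha(X;x)$ is nonincreasing in $x\in\mathbb R$. 5. *Values:* if $X\in\mathcal X_\alpha$, then $P_\alpha(X;x)\in[0,1]$ for all $x$. 6. *$\alpha$-concavity in $x$:* let $X\in\mathcal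 X_\alpha$. If $0<\alpha<\infty$, then $x\mapsto P_\alpha(X;x)^{-1/\alpha}\in[0,\infty]$ is convex on $\mathbb R$ (where $0^{-1/\alpha}:=\infty$). If $\alpha=\infty$, then $x\mapsto\ln P_\infty(X;x)\in[-\infty,0]$ is concave on $\mathbb R$ (where $\ln0:=-\infty$). 7. *Stability in $x$:* if $\alpha\in(0,\infty]$ and $X\in\mathcal X_\alpha$, then $x\mapsto P_\alpha(X;x)$ is continuous at every $x\in\mathbb R$, except that it is discontinuous at $x=x_*$ when $p_*>0$. 8. *Stability in $\alpha$:* if $(\alpha_n)$ is a sequence in $[0,\infty)$ converging to $\alpha$, and $X\in\mathcal X_\beta$ with $\beta:=\sup_n\alpha_n$, then $P_{\alpha_n}(X;x)\to P_\alpha(X;x)$ for all $x\in\mathbb R$. 9. *Stability in $X$:* let $\alpha\in(0,\infty]$ and $X\in\mathcal X_\alpha$, and let $(X_n)$ be a sequence of real-valued random variables converging to $X$ in distribution, such that, as $N\to\infty$, $\sup_n\mathsf E (X_n)_+^\alpha\mathbf 1\{X_n>N\}\to0$ if $\alpha<\infty$, and $\sup_n\mathsf E e^{\lambda X_n}\mathbf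 1\{X_n>N\}\to0$ for each $\lambda\in\Lambda_X$ if $\alpha=\infty$. Then $P_\alpha(X_n;x)\to P_\alpha(X;x)$ for every real $x\ne x_*$, and also for $x=x_*$ (if $x_* < \infty$) provided that $\mathsf P(X_n=x_*)\to\mathsf P(X=x_*)$, in particular if $\mathsf P(X=x_*)=0$. 10. *Translation invariance:* $P_\alpha(X+c;x+c)=P_\alpha(X;x)$ for all real $c$ and $x$. 11. *Consistency:* $P_\alpha(c;x)=P_0(c;x)=\mathbf 1\{c\ge x\}$ for all real $c$ and $x$. 12. *Positive homogeneity:* $P_\alpha(\kappa X;\kappa x)=P_\alpha(X;x)$ for all real $\kappa>0$ and all real $x$. -/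

import Mathlib

open MeasureTheory ProbabilityTheory Filter Topology
open scoped ENNReal NNReal

noncomputable section

/-- The generalized moment functions `h_α`, `α ∈ [0, ∞]`: `h_0(u) = 1{u ≥ 0}`,
`h_α(u) = (1 + u/α)_+^α` for `0 < α < ∞`, and `h_∞(u) = e^u`. -/
def hFun (α : ℝ≥0∞) (u : ℝ) : ℝ :=
  if α = 0 then (if 0 ≤ u then 1 else 0)
  else if α = ∞ then Real.exp u
  else (max 0 (1 + u / α.toReal)) ^ α.toReal

/-- `A_α(X; x)(l) = E h_α(l (X - x))`, with values in `[0, ∞]`. -/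
def genMoment {Ω : Type*} [MeasurableSpace Ω] (μ : Measure Ω) (α : ℝ≥0∞) (X : Ω → ℝ)
    (x l : ℝ) : ℝ≥0∞ :=
  ∫⁻ ω, ENNReal.ofReal (hFun α (l * (X ω - x))) ∂μ

/-- The tail bound `P_α(X; x) = inf_{l > 0} A_α(X; x)(l)`. -/
def tailBound {Ω : Type*} [MeasurableSpace Ω] (μ : Measure Ω) (α : ℝ≥0∞) (X : Ω → ℝ)
    (x : ℝ) : ℝ≥0∞ :=
  ⨅ l ∈ Set.Ioi (0 : ℝ), genMoment μ α X x l

/-- The set `Λ_X` of all real `l > 0` with `E e^{l X} < ∞`. -/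
def expMomentSet {Ω : Type*} [MeasurableSpace Ω] (μ : Measure Ω) (X : Ω → ℝ) : Set ℝ :=
  {l : ℝ | 0 < l ∧ ∫⁻ ω, ENNReal.ofReal (Real.exp (l * X ω)) ∂μ < ∞}

/-- The integrability condition defining the class of random variables for which `P_α` is
considered: none if `α = 0`, `E X_+^α < ∞` if `0 < α < ∞`, and `Λ_X ≠ ∅` if `α = ∞`. -/
def HasTailMoment {Ω : Type*} [MeasurableSpace Ω] (μ : Measure Ω) (α : ℝ≥0∞)
    (X : Ω → ℝ) : Prop :=
  if α = 0 then True
  else if α = ∞ then (expMomentSet μ X).Nonempty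
  else ∫⁻ ω, ENNReal.ofReal ((max 0 (X ω)) ^ α.toReal) ∂μ < ∞

/-- `x_* = sup supp X`, an element of `(-∞, ∞]` when `X` is a random variable. -/
def xStar {Ω : Type*} [MeasurableSpace Ω] (μ : Measure Ω) (X : Ω → ℝ) : EReal :=
  sSup ((fun r : ℝ => (r : EReal)) '' (μ.map X).support)

/-- `p_* = P(X = x_*)`. -/
def pStar {Ω : Type*} [MeasurableSpace Ω] (μ : Measure Ω) (X : Ω → ℝ) : ℝ≥0∞ :=
  μ {ω | (X ω : EReal) = xStar μ X}

/-- The index set `T_α`: the real line if `α < ∞`, and `(0, ∞)` if `α = ∞`. -/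
def indexSet (α : ℝ≥0∞) : Set ℝ :=
  if α = ∞ then Set.Ioi 0 else Set.univ

/-- `g_{α;t}(u) = (u - t)_+^α` for `α < ∞`, where `0^0 = 0` (so that `g_{0;t}(u) = 1{u > t}`),
and `g_{∞;t}(u) = e^{u/t}`. -/
def gFun (α : ℝ≥0∞) (t u : ℝ) : ℝ :=
  if α = 0 then (if t < u then 1 else 0)
  else if α = ∞ then Real.exp (u / t)
  else (max 0 (u - t)) ^ α.toReal

/-- The class `H^α` of all real functions `g` on `ℝ` of the form
`g(u) = ∫_{T_α} g_{α;t}(u) ν(dt)` for some nonnegative Borel measure `ν` on `T_α`. -/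
def momentClass (α : ℝ≥0∞) : Set (ℝ → ℝ) :=
  {g | ∃ ν : Measure ℝ, ∀ u : ℝ,
    0 ≤ g u ∧ ∫⁻ t in indexSet α, ENNReal.ofReal (gFun α t u) ∂ν = ENNReal.ofReal (g u)}

/-- Stochastic dominance of order `α + 1`: `E g(X) ≤ E g(Y)` for all `g ∈ H^α`. -/
def StochDom {Ω Ω' : Type*} [MeasurableSpace Ω] [MeasurableSpace Ω'] (α : ℝ≥0∞)
    (μ : Measure Ω) (X : Ω → ℝ) (ν : Measure Ω') (Y : Ω' → ℝ) : Prop :=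
  ∀ g ∈ momentClass α,
    ∫⁻ ω, ENNReal.ofReal (g (X ω)) ∂μ ≤ ∫⁻ ω, ENNReal.ofReal (g (Y ω)) ∂ν

/-- The uniform integrability condition on a sequence `Xs` with limit `X`, for `0 < α ≤ ∞`:
`sup_n E (X_n)_+^α 1{X_n > N} → 0` as `N → ∞` if `α < ∞`, and
`sup_n E e^{l X_n} 1{X_n > N} → 0` as `N → ∞` for each `l ∈ Λ_X` if `α = ∞`. -/
def UnifIntTail {Ω : Type*} {Ωs : ℕ → Type*} [MeasurableSpace Ω] [∀ n, MeasurableSpace (Ωs n)]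
    (α : ℝ≥0∞) (μs : ∀ n, Measure (Ωs n)) (Xs : ∀ n, Ωs n → ℝ)
    (μ : Measure Ω) (X : Ω → ℝ) : Prop :=
  if α = ∞ then
    ∀ l ∈ expMomentSet μ X,
      Tendsto (fun N : ℝ => ⨆ n, ∫⁻ ω in {ω | N < Xs n ω},
        ENNReal.ofReal (Real.exp (l * Xs n ω)) ∂(μs n)) atTop (𝓝 0)
  else
    Tendsto (fun N : ℝ => ⨆ n, ∫⁻ ω in {ω | N < Xs n ω},
      ENNReal.ofReal ((max 0 (Xs n ω)) ^ α.toReal) ∂(μs n)) atTop (𝓝 0)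

end

/-! Everything is read off the family of generalized moments E h_α(l(X - x)), l > 0, whose infimum
is the tail bound. Since h_α is nondecreasing in α (Bernoulli) and in its argument, the monotonicity
claims hold moment by moment. The limits l → 0 and l → ∞ give the bound 1 and, when X ≤ x almost
surely, the exact value P(X = x). For 0 < α < ∞, h_α(l(u - x)) is a positive multiple of (u - t)_+^α
with t = x - α/l. Hence dominance of order α + 1 compares the moments, and dominance of lower order
suffices because Beta and Gamma integrals write g_{α;t} as a mixture of lower-order kernels
(`exists_const_mul_gFun_mem_momentClass`). For fixed t the moment to the power -1/α is affine in x,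
so the same power of the tail bound is a supremum of functions c(x - t)_+ and is convex. For α = ∞
the logarithm of each moment is affine in x. For stability, an infimum inherits upper semicontinuity
from the moments, where dominated convergence or uniform integrability applies. Lower semicontinuity
(`eventually_le_tailBound`) comes from compactness of [0, ∞]: parameters l_n giving values that are
too small accumulate at some L. If L < ∞, Fatou contradicts the value of the bound; if L = ∞, the
moments blow up because P(X > x) > 0. At and beyond x_* the bound is P(X = x). -/

/-! ### Monotonicity, limits and continuity of h_α. -/

lemma hFun_zero_left (u : ℝ) : hFun 0 u = if 0 ≤ u then 1 else 0 := by simp [hFun]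

lemma hFun_top_left (u : ℝ) : hFun ∞ u = Real.exp u := by simp [hFun]

lemma hFun_of_ne {α : ℝ≥0∞} (h0 : α ≠ 0) (h1 : α ≠ ∞) (u : ℝ) :
    hFun α u = (max 0 (1 + u / α.toReal)) ^ α.toReal := by simp [hFun, h0, h1]

lemma hFun_nonneg (α : ℝ≥0∞) (u : ℝ) : 0 ≤ hFun α u := by
  unfold hFun
  split_ifs <;> positivity

lemma hFun_monotone (α : ℝ≥0∞) : Monotone (hFun α) := by
  intro u v huv
  rcases eq_or_ne α 0 with rfl | h0
  · simp only [hFun_zero_left]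
    split_ifs <;> linarith
  rcases eq_or_ne α ∞ with rfl | h1
  · simpa [hFun_top_left] using huv
  · have := ENNReal.toReal_pos h0 h1
    simp only [hFun_of_ne h0 h1]
    gcongr

lemma measurable_hFun (α : ℝ≥0∞) : Measurable (hFun α) := (hFun_monotone α).measurable

lemma hFun_apply_zero (α : ℝ≥0∞) : hFun α 0 = 1 := by
  simp [hFun]

lemma hFun_le_one (α : ℝ≥0∞) {u : ℝ} (hu : u ≤ 0) : hFun α u ≤ 1 :=
  hFun_apply_zero α ▸ hFun_monotone α hu

lemma one_le_hFun (α : ℝ≥0∞) {u : ℝ} (hu : 0 ≤ u) : 1 ≤ hFun α u :=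
  hFun_apply_zero α ▸ hFun_monotone α hu

/-- For finite orders 0 < a ≤ b this is Bernoulli's inequality (1 + s)^p ≤ 1 + ps with s = u/a and p
= a/b ≤ 1, raised to the power b. For b = ∞ it is 1 + s ≤ e^s. -/
lemma hFun_monotone_left (u : ℝ) : Monotone (fun α => hFun α u) := by
  intro a b hab
  rcases eq_or_ne a 0 with rfl | ha0
  · show hFun 0 u ≤ hFun b u
    rw [hFun_zero_left]
    split_ifs with h
    · exact one_le_hFun b h
    · exact hFun_nonneg b u
  rcases eq_or_ne a ∞ with rfl | ha1
  · rw [top_le_iff.1 hab]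
  have hpa := ENNReal.toReal_pos ha0 ha1
  show hFun a u ≤ hFun b u
  rcases le_or_gt (1 + u / a.toReal) 0 with h | h
  · rw [hFun_of_ne ha0 ha1, max_eq_left h, Real.zero_rpow hpa.ne']
    exact hFun_nonneg b u
  rw [hFun_of_ne ha0 ha1, max_eq_right h.le]
  rcases eq_or_ne b ∞ with rfl | hb1
  · rw [hFun_top_left]
    calc (1 + u / a.toReal) ^ a.toReal ≤ (Real.exp (u / a.toReal)) ^ a.toReal := by
          gcongr
          linarith [Real.add_one_le_exp (u / a.toReal)]
      _ = Real.exp u := by rw [← Real.exp_mul, div_mul_cancel₀ _ hpa.ne']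
  have hb0 : b ≠ 0 := (lt_of_lt_of_le (pos_iff_ne_zero.2 ha0) hab).ne'
  have hpb := ENNReal.toReal_pos hb0 hb1
  have hab' : a.toReal ≤ b.toReal := ENNReal.toReal_mono hb1 hab
  have key := rpow_one_add_le_one_add_mul_self (s := u / a.toReal) (by linarith)
    (p := a.toReal / b.toReal) (by positivity) ((div_le_one hpb).2 hab')
  have e : a.toReal / b.toReal * (u / a.toReal) = u / b.toReal := by
    field_simp
  rw [e] at key
  rw [hFun_of_ne hb0 hb1]
  calc (1 + u / a.toReal) ^ a.toReal
      = ((1 + u / a.toReal) ^ (a.toReal / b.toReal)) ^ b.toReal := by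
        rw [← Real.rpow_mul h.le, div_mul_cancel₀ _ hpb.ne']
    _ ≤ (max 0 (1 + u / b.toReal)) ^ b.toReal := by
        gcongr
        exact key.trans (le_max_right _ _)

lemma tendsto_hFun_atTop {α : ℝ≥0∞} (h0 : α ≠ 0) : Tendsto (hFun α) atTop atTop := by
  obtain ⟨γ, hγ0, hγ⟩ := exists_between (lt_min (pos_iff_ne_zero.2 h0) one_pos :
    (0 : ℝ≥0∞) < min α 1)
  have hγ1 : γ ≠ ∞ := ((hγ.trans_le (min_le_right _ _)).trans ENNReal.one_lt_top).ne
  have hp := ENNReal.toReal_pos hγ0.ne' hγ1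
  refine tendsto_atTop_mono (fun u => hFun_monotone_left u (hγ.trans_le (min_le_left _ _)).le) ?_
  simp only [hFun_of_ne hγ0.ne' hγ1]
  refine (tendsto_rpow_atTop hp).comp ?_
  refine tendsto_atTop_mono (fun u => le_max_right _ _) ?_
  exact tendsto_atTop_add_const_left _ _ (tendsto_id.atTop_div_const hp)

lemma tendsto_hFun_atBot {α : ℝ≥0∞} : Tendsto (hFun α) atBot (𝓝 0) :=
  squeeze_zero (hFun_nonneg α)
    (fun u => (hFun_monotone_left u le_top).trans_eq (hFun_top_left u)) Real.tendsto_exp_atBot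

/-- Joint continuity of `(α, u) ↦ h_α(u)` at every point with `α ≠ 0`. -/
lemma tendsto_hFun {ι : Type*} {l : Filter ι} {αs : ι → ℝ≥0∞} {α : ℝ≥0∞} {us : ι → ℝ} {u : ℝ}
    (hα : Tendsto αs l (𝓝 α)) (h0 : α ≠ 0) (hu : Tendsto us l (𝓝 u)) :
    Tendsto (fun i => hFun (αs i) (us i)) l (𝓝 (hFun α u)) := by
  have main : ∀ {ι : Type _} {l : Filter ι} {αs : ι → ℝ≥0∞} {α : ℝ≥0∞} {us : ι → ℝ} {u : ℝ},
      Tendsto αs l (𝓝 α) → α ≠ 0 → α ≠ ∞ → Tendsto us l (𝓝 u) →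
      Tendsto (fun i => hFun (αs i) (us i)) l (𝓝 (hFun α u)) := by
    intro ι l αs α us u hα h0 h1 hu
    have hp := ENNReal.toReal_pos h0 h1
    have hr : Tendsto (fun i => (αs i).toReal) l (𝓝 α.toReal) :=
      (ENNReal.tendsto_toReal h1).comp hα
    have : Tendsto (fun i => (max 0 (1 + us i / (αs i).toReal)) ^ (αs i).toReal) l
        (𝓝 (hFun α u)) := by
      rw [hFun_of_ne h0 h1]
      exact (tendsto_const_nhds.max (tendsto_const_nhds.add (hu.div hr hp.ne'))).rpow hr
        (Or.inr hp)
    refine this.congr' ?_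
    filter_upwards [hα.eventually_ne h0, hα.eventually_ne h1] with i hi0 hi1
    rw [hFun_of_ne hi0 hi1]
  rcases ne_or_eq α ∞ with h1 | rfl
  · exact main hα h0 h1 hu
  -- At order ∞, monotonicity in the order reduces the lower bound to one finite order r with (1 +
  -- u/r)^r > c, and the upper bound to continuity of exp.
  refine tendsto_order.2 ⟨fun c hc => ?_, fun c hc => ?_⟩
  · have ht : Tendsto (fun r : ℝ => (1 + u / r) ^ r) atTop (𝓝 (hFun ∞ u)) := by
      rw [hFun_top_left]
      exact Real.tendsto_one_add_div_rpow_exp u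
    obtain ⟨r, hr, hr0⟩ := ((ht.eventually (lt_mem_nhds hc)).and
      (eventually_gt_atTop (max 0 (-u)))).exists
    have hr1 : 0 < r := (le_max_left _ _).trans_lt hr0
    have hr2 : -u < r := (le_max_right _ _).trans_lt hr0
    have hg0 : ENNReal.ofReal r ≠ 0 := by simpa using hr1
    have hcu : c < hFun (ENNReal.ofReal r) u := by
      rw [hFun_of_ne hg0 ENNReal.ofReal_ne_top, ENNReal.toReal_ofReal hr1.le, max_eq_right]
      · exact hr
      · have : -1 ≤ u / r := by rw [le_div_iff₀ hr1]; linarith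
        linarith
    have hlim := main (tendsto_const_nhds (x := ENNReal.ofReal r)) hg0 ENNReal.ofReal_ne_top hu
    filter_upwards [hlim.eventually (lt_mem_nhds hcu),
      hα.eventually (lt_mem_nhds ENNReal.ofReal_lt_top)] with i hi1 hi2
    exact hi1.trans_le (hFun_monotone_left _ hi2.le)
  · have hlim : Tendsto (fun i => hFun ∞ (us i)) l (𝓝 (hFun ∞ u)) := by
      simp only [hFun_top_left]
      exact (Real.continuous_exp.tendsto u).comp hu
    filter_upwards [hlim.eventually (gt_mem_nhds hc)] with i hi
    exact (hFun_monotone_left _ le_top).trans_lt hi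

lemma continuous_hFun {α : ℝ≥0∞} (h0 : α ≠ 0) : Continuous (hFun α) :=
  continuous_iff_continuousAt.2 fun _ => tendsto_hFun tendsto_const_nhds h0 tendsto_id

/-- Joint continuity fails at α = 0, u = 0, so here u stays fixed. -/
lemma tendsto_hFun_left {ι : Type*} {l : Filter ι} {αs : ι → ℝ≥0∞} {α : ℝ≥0∞} (u : ℝ)
    (hα : Tendsto αs l (𝓝 α)) : Tendsto (fun i => hFun (αs i) u) l (𝓝 (hFun α u)) := by
  rcases ne_or_eq α 0 with h0 | rfl
  · exact tendsto_hFun hα h0 tendsto_const_nhds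
  have hr : Tendsto (fun i => (αs i).toReal) l (𝓝 0) := by
    simpa [Function.comp_def] using (ENNReal.tendsto_toReal ENNReal.zero_ne_top).comp hα
  have h1 := hα.eventually_ne ENNReal.zero_ne_top
  rcases lt_trichotomy u 0 with hu | rfl | hu
  -- As soon as the order drops below -u, the positive part vanishes.
  · refine tendsto_const_nhds.congr' ?_
    filter_upwards [h1, hr.eventually (gt_mem_nhds (neg_pos.2 hu))] with i hi1 hi2
    rw [hFun_zero_left, if_neg hu.not_ge]
    rcases eq_or_ne (αs i) 0 with h | h
    · rw [h, hFun_zero_left, if_neg hu.not_ge]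
    have hp := ENNReal.toReal_pos h hi1
    rw [hFun_of_ne h hi1, max_eq_left, Real.zero_rpow hp.ne']
    have : u / (αs i).toReal ≤ -1 := by rw [div_le_iff₀ hp]; linarith
    linarith
  · simp only [hFun_apply_zero]
    exact tendsto_const_nhds
  · rw [hFun_zero_left, if_pos hu.le]
    -- From log y ≤ 2√y, r log(1 + u/r) ≤ 2√(r² + ur), which is continuous and zero at r = 0.
    have hup : Tendsto (fun i => Real.exp (2 * √((αs i).toReal ^ 2 + u * (αs i).toReal))) l
        (𝓝 1) := by
      have : Continuous fun r : ℝ => Real.exp (2 * √(r ^ 2 + u * r)) := by fun_prop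
      simpa [Function.comp_def] using (this.tendsto 0).comp hr
    refine tendsto_of_tendsto_of_tendsto_of_le_of_le' tendsto_const_nhds hup
      (Eventually.of_forall fun i => one_le_hFun _ hu.le) ?_
    filter_upwards [h1] with i hi1
    rcases eq_or_ne (αs i) 0 with h | h
    · rw [h, hFun_zero_left, if_pos hu.le]
      exact Real.one_le_exp (by positivity)
    have hp := ENNReal.toReal_pos h hi1
    set r := (αs i).toReal
    have hy : 0 < 1 + u / r := by positivity
    rw [hFun_of_ne h hi1, max_eq_right hy.le, Real.rpow_def_of_pos hy, Real.exp_le_exp]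
    have hlog : Real.log (1 + u / r) ≤ 2 * √(1 + u / r) := by
      have h2 := Real.log_le_sub_one_of_pos (Real.sqrt_pos.2 hy)
      rw [Real.log_sqrt hy.le] at h2
      linarith
    have e : √(r ^ 2 + u * r) = √(1 + u / r) * r := by
      rw [show r ^ 2 + u * r = (1 + u / r) * r ^ 2 by field_simp, Real.sqrt_mul hy.le,
        Real.sqrt_sq hp.le]
    rw [e]
    nlinarith

/-! ### The kernels g_{α;t} and inclusions between the classes H^α. -/

lemma gFun_nonneg (α : ℝ≥0∞) (t u : ℝ) : 0 ≤ gFun α t u := by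
  unfold gFun
  split_ifs <;> positivity

lemma gFun_of_ne_top {α : ℝ≥0∞} (h1 : α ≠ ∞) (t u : ℝ) :
    gFun α t u = if t < u then (u - t) ^ α.toReal else 0 := by
  rcases eq_or_ne α 0 with rfl | h0
  · simp [gFun]
  have hp := ENNReal.toReal_pos h0 h1
  simp only [gFun, h0, h1, if_false]
  split_ifs with h
  · rw [max_eq_right (by linarith)]
  · rw [max_eq_left (by linarith), Real.zero_rpow hp.ne']

lemma gFun_top (t u : ℝ) : gFun ∞ t u = Real.exp (u / t) := by simp [gFun]

lemma measurable_gFun_left {α : ℝ≥0∞} (h1 : α ≠ ∞) (u : ℝ) : Measurable (fun t => gFun α t u) := by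
  simp only [gFun_of_ne_top h1]
  exact Measurable.ite measurableSet_Iio (by fun_prop) measurable_const

lemma measurable_gFun (α : ℝ≥0∞) (t : ℝ) : Measurable (gFun α t) := by
  rcases eq_or_ne α ∞ with rfl | h1
  · simp only [funext (gFun_top t)]
    fun_prop
  · simp only [funext (gFun_of_ne_top h1 t)]
    exact Measurable.ite measurableSet_Ioi (by fun_prop) measurable_const

/-- Functions `g` proportional to a mixture of the `g_{β;s}` with a density belong to `H^β`. -/
lemma const_mul_mem_momentClass {β : ℝ≥0∞} (h1 : β ≠ ∞) {w : ℝ → ℝ≥0∞} (hw : Measurable w)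
    {g : ℝ → ℝ} (hg : ∀ u, 0 ≤ g u) {B : ℝ≥0∞} (hB : B ≠ ∞)
    (h : ∀ u, ∫⁻ s, ENNReal.ofReal (gFun β s u) * w s = B * ENNReal.ofReal (g u)) :
    (fun u => B.toReal * g u) ∈ momentClass β := by
  refine ⟨volume.withDensity w, fun u => ⟨mul_nonneg ENNReal.toReal_nonneg (hg u), ?_⟩⟩
  rw [indexSet, if_neg h1, Measure.restrict_univ, lintegral_withDensity_eq_lintegral_mul _ hw
    (measurable_gFun_left h1 u).ennreal_ofReal, ENNReal.ofReal_mul ENNReal.toReal_nonneg,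
    ENNReal.ofReal_toReal hB, ← h u]
  exact lintegral_congr fun s => mul_comm _ _

lemma gFun_mem_momentClass {α : ℝ≥0∞} {t : ℝ} (ht : t ∈ indexSet α) :
    gFun α t ∈ momentClass α := by
  refine ⟨Measure.dirac t, fun u => ⟨gFun_nonneg _ _ _, ?_⟩⟩
  have : MeasurableSet (indexSet α) := by
    unfold indexSet
    split_ifs
    exacts [measurableSet_Ioi, MeasurableSet.univ]
  classical
  rw [restrict_dirac' this, if_pos ht, lintegral_dirac]

lemma lintegral_comp_affine (f : ℝ → ℝ≥0∞) (t : ℝ) {a : ℝ} (ha : 0 < a) :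
    ∫⁻ s, f s = ENNReal.ofReal a * ∫⁻ r, f (t + a * r) := by
  have e : MeasurableEmbedding (fun r : ℝ => a * r) := measurableEmbedding_mulLeft₀ ha.ne'
  have h1 : ∫⁻ r, f (t + a * r) = ∫⁻ s, f (t + s) ∂(Measure.map (fun r : ℝ => a * r) volume) :=
    (e.lintegral_map (fun s => f (t + s))).symm
  have h2 : Measure.map (fun r : ℝ => a * r) volume
      = ENNReal.ofReal a⁻¹ • (volume : Measure ℝ) := by
    have := Real.map_volume_mul_left ha.ne'
    rwa [abs_of_pos (inv_pos.2 ha)] at this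
  rw [h1, h2, lintegral_smul_measure, smul_eq_mul, ← mul_assoc, ← ENNReal.ofReal_mul ha.le,
    mul_inv_cancel₀ ha.ne', ENNReal.ofReal_one, one_mul, lintegral_add_left_eq_self]

lemma lintegral_ne_zero_of_forall_mem_Ioo {f : ℝ → ℝ≥0∞} (hf : Measurable f)
    (h : ∀ r ∈ Set.Ioo (0 : ℝ) 1, f r ≠ 0) : ∫⁻ r, f r ≠ 0 := by
  refine ((lintegral_pos_iff_support hf).2 (lt_of_lt_of_le ?_ (measure_mono h))).ne'
  simp

/-- The normalizing constants of the Beta integral. -/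
lemma exists_beta_const {b e : ℝ} (hb : 0 ≤ b) (he : -1 < e) :
    ∫⁻ r, ENNReal.ofReal (if r < 1 then (1 - r) ^ b else 0) *
      ENNReal.ofReal (if 0 < r then r ^ e else 0) ≠ 0 ∧
    ∫⁻ r, ENNReal.ofReal (if r < 1 then (1 - r) ^ b else 0) *
      ENNReal.ofReal (if 0 < r then r ^ e else 0) ≠ ∞ := by
  constructor
  · refine lintegral_ne_zero_of_forall_mem_Ioo (Measurable.mul
      (Measurable.ite measurableSet_Iio (by fun_prop) measurable_const).ennreal_ofReal
      (Measurable.ite measurableSet_Ioi (by fun_prop) measurable_const).ennreal_ofReal) ?_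
    rintro r ⟨h0, h1⟩
    have h2 : 0 < (1 - r) ^ b := Real.rpow_pos_of_pos (by linarith) _
    have h3 : 0 < r ^ e := Real.rpow_pos_of_pos h0 _
    simp [h0, h1, h2, h3]
  · have hi : IntegrableOn (fun r : ℝ => r ^ e) (Set.Ioc 0 1) :=
      (intervalIntegrable_iff_integrableOn_Ioc_of_le zero_le_one).1
        (intervalIntegral.intervalIntegrable_rpow' he)
    refine ne_top_of_le_ne_top hi.lintegral_lt_top.ne ?_
    rw [← lintegral_indicator measurableSet_Ioc]
    refine lintegral_mono fun r => ?_
    by_cases h0 : 0 < r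
    · by_cases h1 : r < 1
      · rw [Set.indicator_of_mem (show r ∈ Set.Ioc 0 1 from ⟨h0, h1.le⟩)]
        simp only [h0, h1, if_true]
        refine mul_le_of_le_one_left' (ENNReal.ofReal_le_one.2 ?_)
        exact Real.rpow_le_one (by linarith) (by linarith) hb
      · simp [h1]
    · simp [h0]

/-- The normalizing constants of the Gamma integral. -/
lemma exists_gamma_const {b t : ℝ} (hb : 0 ≤ b) (ht : 0 < t) :
    ∫⁻ r, ENNReal.ofReal (if 0 < r then r ^ b else 0) * ENNReal.ofReal (Real.exp (-r / t)) ≠ 0 ∧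
    ∫⁻ r, ENNReal.ofReal (if 0 < r then r ^ b else 0) * ENNReal.ofReal (Real.exp (-r / t)) ≠ ∞ := by
  constructor
  · refine lintegral_ne_zero_of_forall_mem_Ioo (Measurable.mul
      (Measurable.ite measurableSet_Ioi (by fun_prop) measurable_const).ennreal_ofReal
      (by fun_prop)) ?_
    rintro r ⟨h0, h1⟩
    have h3 : 0 < r ^ b := Real.rpow_pos_of_pos h0 _
    simp [h0, h3, Real.exp_pos]
  · have hi : IntegrableOn (fun r : ℝ => r ^ b * Real.exp (-(1 / t) * r)) (Set.Ioi 0) := by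
      simpa using integrableOn_rpow_mul_exp_neg_mul_rpow (p := 1) (s := b) (b := 1 / t)
        (by linarith) one_pos (by positivity)
    refine ne_top_of_le_ne_top hi.lintegral_lt_top.ne ?_
    rw [← lintegral_indicator measurableSet_Ioi]
    refine lintegral_mono fun r => ?_
    by_cases h0 : 0 < r
    · rw [Set.indicator_of_mem (show r ∈ Set.Ioi 0 from h0)]
      simp only [h0, if_true]
      rw [← ENNReal.ofReal_mul (by positivity)]
      refine le_of_eq ?_
      congr 3
      ring
    · simp [h0]

/-- For finite α, (u - t)_+^α is proportional to ∫ (u - s)_+^β (s - t)_+^(α-β-1) ds (Beta integral).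
For α = ∞, e^{u/t} is proportional to ∫ (u - s)_+^β e^{s/t} ds (Gamma integral). -/
lemma exists_const_mul_gFun_mem_momentClass {α β : ℝ≥0∞} (hβα : β < α) {t : ℝ}
    (ht : t ∈ indexSet α) :
    ∃ B : ℝ, 0 < B ∧ (fun u => B * gFun α t u) ∈ momentClass β := by
  have hβ : β ≠ ∞ := hβα.ne_top
  have hb : 0 ≤ β.toReal := ENNReal.toReal_nonneg
  rcases eq_or_ne α ∞ with rfl | hα
  · have ht0 : 0 < t := by simpa [indexSet] using ht
    obtain ⟨h0, h1⟩ := exists_gamma_const hb ht0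
    refine ⟨_, ENNReal.toReal_pos h0 h1, const_mul_mem_momentClass hβ
      (w := fun s => ENNReal.ofReal (Real.exp (s / t))) (by fun_prop) (gFun_nonneg _ _) h1 ?_⟩
    intro u
    -- Substituting s = u - r factors out e^{u/t}.
    rw [← lintegral_sub_left_eq_self _ u, ← lintegral_mul_const' _ _ ENNReal.ofReal_ne_top]
    refine lintegral_congr fun r => ?_
    rw [mul_assoc, ← ENNReal.ofReal_mul (Real.exp_pos _).le, gFun_top, ← Real.exp_add,
      gFun_of_ne_top hβ]
    congr 3
    · simp
    · ring_nf
    · ring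
  · have hlt : β.toReal < α.toReal := (ENNReal.toReal_lt_toReal hβ hα).2 hβα
    obtain ⟨h0, h1⟩ := exists_beta_const hb (e := α.toReal - β.toReal - 1) (by linarith)
    refine ⟨_, ENNReal.toReal_pos h0 h1, const_mul_mem_momentClass hβ
      (w := fun s => ENNReal.ofReal (if t < s then (s - t) ^ (α.toReal - β.toReal - 1) else 0))
      (Measurable.ite measurableSet_Ioi (by fun_prop) measurable_const).ennreal_ofReal
      (gFun_nonneg _ _) h1 ?_⟩
    intro u
    rw [gFun_of_ne_top hα]
    split_ifs with htu
    · have ha : 0 < u - t := by linarith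
      -- Substituting s = t + (u - t)r factors out (u - t)^α.
      rw [lintegral_comp_affine _ t ha, ← lintegral_const_mul' _ _ ENNReal.ofReal_ne_top, mul_comm,
        ← lintegral_const_mul' _ _ ENNReal.ofReal_ne_top]
      refine lintegral_congr fun r => ?_
      rw [gFun_of_ne_top hβ]
      have e1 : t + (u - t) * r < u ↔ r < 1 := by
        constructor <;> intro h <;> nlinarith
      have e2 : t < t + (u - t) * r ↔ 0 < r := by
        rw [lt_add_iff_pos_right, mul_pos_iff_of_pos_left ha]
      simp only [e1, e2]
      by_cases h0 : 0 < r
      · by_cases h1 : r < 1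
        · simp only [h0, h1, if_true]
          rw [show u - (t + (u - t) * r) = (u - t) * (1 - r) by ring,
            show t + (u - t) * r - t = (u - t) * r by ring,
            Real.mul_rpow ha.le (by linarith), Real.mul_rpow ha.le h0.le]
          have h2 : 0 ≤ (1 - r) ^ β.toReal := Real.rpow_nonneg (by linarith) _
          have h3 : 0 ≤ r ^ (α.toReal - β.toReal - 1) := Real.rpow_nonneg h0.le _
          rw [← ENNReal.ofReal_mul (by positivity), ← ENNReal.ofReal_mul (by positivity),
            ← ENNReal.ofReal_mul (by positivity), ← ENNReal.ofReal_mul (by positivity)]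
          congr 1
          have e3 : (u - t) ^ α.toReal = (u - t) * ((u - t) ^ β.toReal *
              (u - t) ^ (α.toReal - β.toReal - 1)) := by
            rw [← Real.rpow_add ha]
            nth_rewrite 2 [← Real.rpow_one (u - t)]
            rw [← Real.rpow_add ha]
            congr 1
            ring
          rw [e3]
          ring
        · simp [h1]
      · simp [h0]
    · rw [ENNReal.ofReal_zero, mul_zero, lintegral_eq_zero_iff']
      · refine Eventually.of_forall fun s => ?_
        simp only [gFun_of_ne_top hβ, Pi.zero_apply, mul_eq_zero]
        rcases lt_or_ge s u with h | h
        · right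
          simp [show ¬ t < s by linarith]
        · left
          simp [h.not_gt]
      · refine Measurable.aemeasurable (Measurable.mul
          (measurable_gFun_left hβ u).ennreal_ofReal ?_)
        exact (Measurable.ite measurableSet_Ioi (by fun_prop) measurable_const).ennreal_ofReal

lemma StochDom.lintegral_gFun_le {Ω Ω' : Type*} [MeasurableSpace Ω] [MeasurableSpace Ω']
    {μ : Measure Ω} {ν : Measure Ω'} {X : Ω → ℝ} {Y : Ω' → ℝ} {α β : ℝ≥0∞}
    (h : StochDom β μ X ν Y) (hβα : β ≤ α) {t : ℝ} (ht : t ∈ indexSet α) :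
    ∫⁻ ω, ENNReal.ofReal (gFun α t (X ω)) ∂μ ≤ ∫⁻ ω, ENNReal.ofReal (gFun α t (Y ω)) ∂ν := by
  rcases hβα.eq_or_lt with rfl | hlt
  · exact h _ (gFun_mem_momentClass ht)
  obtain ⟨B, hB, hmem⟩ := exists_const_mul_gFun_mem_momentClass hlt ht
  have := h _ hmem
  simp only [ENNReal.ofReal_mul hB.le] at this
  rw [lintegral_const_mul' _ _ ENNReal.ofReal_ne_top,
    lintegral_const_mul' _ _ ENNReal.ofReal_ne_top] at this
  exact (ENNReal.mul_le_mul_iff_right (by simpa using hB) ENNReal.ofReal_ne_top).1 this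

/-! ### Elementary properties of the tail bound. -/

section TailBoundBasics

variable {Ω Ω' : Type*} [MeasurableSpace Ω] [MeasurableSpace Ω'] {μ : Measure Ω} {ν : Measure Ω'}
  {X : Ω → ℝ} {Y : Ω' → ℝ} {α β : ℝ≥0∞}

lemma le_tailBound_iff {x : ℝ} {c : ℝ≥0∞} :
    c ≤ tailBound μ α X x ↔ ∀ l : ℝ, 0 < l → c ≤ genMoment μ α X x l := by
  simp [tailBound, le_iInf_iff]

lemma tailBound_le_genMoment (x : ℝ) {l : ℝ} (hl : 0 < l) :
    tailBound μ α X x ≤ genMoment μ α X x l := le_tailBound_iff.1 le_rfl l hl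

lemma tailBound_lt_iff {x : ℝ} {c : ℝ≥0∞} :
    tailBound μ α X x < c ↔ ∃ l : ℝ, 0 < l ∧ genMoment μ α X x l < c := by
  simp [tailBound, iInf_lt_iff]

lemma tailBound_le_tailBound {x y : ℝ}
    (h : ∀ l : ℝ, 0 < l → genMoment μ α X x l ≤ genMoment ν β Y y l) :
    tailBound μ α X x ≤ tailBound ν β Y y :=
  le_tailBound_iff.2 fun l hl => (tailBound_le_genMoment x hl).trans (h l hl)

lemma measurable_ofReal_hFun (hX : Measurable X) (α : ℝ≥0∞) (x l : ℝ) :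
    Measurable fun ω => ENNReal.ofReal (hFun α (l * (X ω - x))) :=
  ((measurable_hFun α).comp (by fun_prop : Measurable fun ω => l * (X ω - x))).ennreal_ofReal

lemma genMoment_eq_lintegral_map (hX : Measurable X) (x l : ℝ) :
    genMoment μ α X x l = ∫⁻ u, ENNReal.ofReal (hFun α (l * (u - x))) ∂(μ.map X) :=
  (lintegral_map (measurable_ofReal_hFun measurable_id α x l) hX).symm

lemma tailBound_congr_map (hX : Measurable X) (hY : Measurable Y) (h : μ.map X = ν.map Y)
    (x : ℝ) : tailBound μ α X x = tailBound ν α Y x := by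
  simp only [tailBound, genMoment_eq_lintegral_map hX, genMoment_eq_lintegral_map hY, h]

lemma tailBound_mono_left (x : ℝ) : Monotone fun γ : ℝ≥0∞ => tailBound μ γ X x :=
  fun _ _ h => tailBound_le_tailBound fun _ _ =>
    lintegral_mono fun _ => ENNReal.ofReal_le_ofReal (hFun_monotone_left _ h)

lemma tailBound_mono_ae {Z : Ω → ℝ} (h : ∀ᵐ ω ∂μ, X ω ≤ Z ω) (x : ℝ) :
    tailBound μ α X x ≤ tailBound μ α Z x := by
  refine tailBound_le_tailBound fun l hl => lintegral_mono_ae ?_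
  filter_upwards [h] with ω hω
  exact ENNReal.ofReal_le_ofReal (hFun_monotone α (by gcongr))

lemma tailBound_antitone : Antitone fun x : ℝ => tailBound μ α X x :=
  fun _ _ h => tailBound_le_tailBound fun _ _ =>
    lintegral_mono fun _ => ENNReal.ofReal_le_ofReal (hFun_monotone α (by gcongr))

lemma genMoment_zero_left (hX : Measurable X) (x : ℝ) {l : ℝ} (hl : 0 < l) :
    genMoment μ 0 X x l = μ {ω | x ≤ X ω} := by
  have hs : MeasurableSet {ω | x ≤ X ω} := measurableSet_le measurable_const hX
  rw [← lintegral_indicator_one hs]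
  refine lintegral_congr fun ω => ?_
  have : 0 ≤ l * (X ω - x) ↔ x ≤ X ω := by
    rw [mul_nonneg_iff_of_pos_left hl, sub_nonneg]
  by_cases h : x ≤ X ω
  · rw [hFun_zero_left, if_pos (this.2 h), Set.indicator_of_mem (show ω ∈ {ω | x ≤ X ω} from h)]
    simp
  · rw [hFun_zero_left, if_neg (mt this.1 h),
      Set.indicator_of_notMem (show ω ∉ {ω | x ≤ X ω} from h)]
    simp

lemma tailBound_zero_left (hX : Measurable X) (x : ℝ) :
    tailBound μ 0 X x = μ {ω | x ≤ X ω} := by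
  refine le_antisymm ?_ (le_tailBound_iff.2 fun l hl => (genMoment_zero_left hX x hl).ge)
  exact (tailBound_le_genMoment x one_pos).trans_eq (genMoment_zero_left hX x one_pos)

/-- The left side is the tail bound of the smallest order, 0. -/
lemma measure_le_tailBound (hX : Measurable X) (x : ℝ) :
    μ {ω | x ≤ X ω} ≤ tailBound μ α X x :=
  (tailBound_zero_left hX x).ge.trans (tailBound_mono_left x (zero_le (a := α)))

lemma genMoment_top_left (x l : ℝ) :
    genMoment μ ∞ X x l = ENNReal.ofReal (Real.exp (-(l * x))) *
      ∫⁻ ω, ENNReal.ofReal (Real.exp (l * X ω)) ∂μ := by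
  rw [← lintegral_const_mul' _ _ ENNReal.ofReal_ne_top]
  refine lintegral_congr fun ω => ?_
  rw [hFun_top_left, ← ENNReal.ofReal_mul (Real.exp_pos _).le, ← Real.exp_add]
  congr 2
  ring

lemma genMoment_top_left_eq_top_iff (x l : ℝ) :
    genMoment μ ∞ X x l = ∞ ↔ ∫⁻ ω, ENNReal.ofReal (Real.exp (l * X ω)) ∂μ = ∞ := by
  rw [genMoment_top_left, ENNReal.mul_eq_top]
  simp [Real.exp_pos]

lemma genMoment_eq_gFun (h0 : α ≠ 0) (h1 : α ≠ ∞) (x : ℝ) {l : ℝ} (hl : 0 < l) :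
    genMoment μ α X x l = ENNReal.ofReal ((l / α.toReal) ^ α.toReal) *
      ∫⁻ ω, ENNReal.ofReal (gFun α (x - α.toReal / l) (X ω)) ∂μ := by
  have hp := ENNReal.toReal_pos h0 h1
  rw [← lintegral_const_mul' _ _ ENNReal.ofReal_ne_top]
  refine lintegral_congr fun ω => ?_
  rw [← ENNReal.ofReal_mul (by positivity), hFun_of_ne h0 h1]
  congr 1
  simp only [gFun, h0, h1, if_false]
  rw [← Real.mul_rpow (by positivity) (le_max_left _ _), mul_max_of_nonneg _ _ (by positivity),
    mul_zero]
  congr 2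
  field_simp
  ring

lemma StochDom.tailBound_le [IsProbabilityMeasure μ] [IsProbabilityMeasure ν] (hX : Measurable X)
    (hY : Measurable Y) (h : StochDom β μ X ν Y) (hβα : β ≤ α) (x : ℝ) :
    tailBound μ α X x ≤ tailBound ν α Y x := by
  refine tailBound_le_tailBound fun l hl => ?_
  rcases eq_or_ne α 0 with rfl | h0
  · rw [genMoment_zero_left hX x hl, genMoment_zero_left hY x hl]
    -- The kernels of order 0 are indicators of open half-lines; the closed half-line is recovered
    -- by letting t increase to x.
    have key : ∀ t : ℝ, μ {ω | t < X ω} ≤ ν {ω | t < Y ω} := by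
      intro t
      have := h.lintegral_gFun_le hβα (t := t) (by simp [indexSet])
      have e : ∀ t u : ℝ, ENNReal.ofReal (gFun 0 t u) = (Set.Ioi t).indicator 1 u := by
        intro t u
        by_cases h : t < u <;> simp [gFun, h]
      simp only [e] at this
      have e2 : ∀ ω, (Set.Ioi t).indicator (1 : ℝ → ℝ≥0∞) (X ω)
          = {ω | t < X ω}.indicator 1 ω := fun _ => rfl
      have e3 : ∀ ω, (Set.Ioi t).indicator (1 : ℝ → ℝ≥0∞) (Y ω)
          = {ω | t < Y ω}.indicator 1 ω := fun _ => rfl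
      simp only [e2, e3] at this
      rwa [lintegral_indicator_one (measurableSet_lt measurable_const hX),
        lintegral_indicator_one (measurableSet_lt measurable_const hY)] at this
    obtain ⟨u, hu_mono, hu_lt, hu⟩ := exists_seq_strictMono_tendsto x
    have hset : {ω | x ≤ Y ω} = ⋂ n, {ω | u n < Y ω} := by
      ext ω
      simp only [Set.mem_ofPred_eq, Set.mem_iInter]
      exact ⟨fun h n => (hu_lt n).trans_le h, fun h => le_of_tendsto' hu fun n => (h n).le⟩
    have hlim : Tendsto (fun n => ν {ω | u n < Y ω}) atTop (𝓝 (ν {ω | x ≤ Y ω})) := by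
      rw [hset]
      refine tendsto_measure_iInter_atTop
        (fun n => (measurableSet_lt measurable_const hY).nullMeasurableSet) ?_
        ⟨0, measure_ne_top _ _⟩
      exact fun m n hmn ω hω => (hu_mono.monotone hmn).trans_lt hω
    refine ge_of_tendsto' hlim fun n => le_trans (measure_mono fun ω hω => ?_) (key (u n))
    exact (hu_lt n).trans_le hω
  rcases eq_or_ne α ∞ with rfl | h1
  · have := h.lintegral_gFun_le hβα (t := 1 / l) (by simpa [indexSet] using hl)
    simp only [gFun_top, div_div_eq_mul_div, div_one, mul_comm _ l] at this
    rw [genMoment_top_left, genMoment_top_left]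
    gcongr
  · rw [genMoment_eq_gFun h0 h1 x hl, genMoment_eq_gFun h0 h1 x hl]
    gcongr
    exact h.lintegral_gFun_le hβα (by simp [indexSet, h1])

/-- This growth bound carries finiteness, and later uniform integrability, from X_+^α to every
generalized moment. -/
lemma exists_hFun_le (h0 : α ≠ 0) (h1 : α ≠ ∞) (x : ℝ) {l : ℝ} (hl : 0 < l) :
    ∃ C : ℝ, 0 ≤ C ∧ ∀ u : ℝ, hFun α (l * (u - x)) ≤ C + C * (max 0 u) ^ α.toReal := by
  have hp := ENNReal.toReal_pos h0 h1
  set C : ℝ := 1 + l / α.toReal * (1 + |x|) with hC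
  have hC0 : 0 ≤ C := by positivity
  refine ⟨C ^ α.toReal, by positivity, fun u => ?_⟩
  have hm : 1 + l * (u - x) / α.toReal ≤ C * max 1 u := by
    have e : l * (u - x) / α.toReal = l / α.toReal * (u - x) := by ring
    have hk : 0 ≤ l / α.toReal := by positivity
    have h2 : u - x ≤ (1 + |x|) * max 1 u := by
      nlinarith [neg_abs_le x, abs_nonneg x, le_max_left 1 u, le_max_right 1 u]
    rw [e, hC]
    nlinarith [mul_le_mul_of_nonneg_left h2 hk, le_max_left 1 u]
  rw [hFun_of_ne h0 h1]
  calc (max 0 (1 + l * (u - x) / α.toReal)) ^ α.toReal ≤ (C * max 1 u) ^ α.toReal := by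
        gcongr
        exact max_le (by positivity) hm
    _ = C ^ α.toReal * (max 1 u) ^ α.toReal := Real.mul_rpow hC0 (by positivity)
    _ ≤ C ^ α.toReal * (1 + (max 0 u) ^ α.toReal) := by
        gcongr
        rcases le_total u 1 with hu | hu
        · rw [max_eq_left hu, Real.one_rpow]
          linarith [Real.rpow_nonneg (le_max_left 0 u) α.toReal]
        · rw [max_eq_right hu, max_eq_right (by linarith)]
          linarith
    _ = _ := by ring

lemma genMoment_ne_top [IsFiniteMeasure μ] (hX : Measurable X) (h : HasTailMoment μ α X)
    (h1 : α ≠ ∞) (x : ℝ) {l : ℝ} (hl : 0 < l) : genMoment μ α X x l ≠ ∞ := by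
  rcases eq_or_ne α 0 with rfl | h0
  · rw [genMoment_zero_left hX x hl]
    exact measure_ne_top _ _
  simp only [HasTailMoment, h0, h1, if_false] at h
  obtain ⟨C, hC, hbound⟩ := exists_hFun_le h0 h1 x hl
  refine ne_top_of_le_ne_top ?_ (lintegral_mono fun ω => ENNReal.ofReal_le_ofReal (hbound (X ω)))
  simp_rw [ENNReal.ofReal_add hC (mul_nonneg hC (Real.rpow_nonneg (le_max_left _ _) _)),
    ENNReal.ofReal_mul hC]
  rw [lintegral_add_left measurable_const, lintegral_const, lintegral_const_mul' _ _
    ENNReal.ofReal_ne_top]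
  exact ENNReal.add_ne_top.2 ⟨ENNReal.mul_ne_top ENNReal.ofReal_ne_top (measure_ne_top _ _),
    ENNReal.mul_ne_top ENNReal.ofReal_ne_top h.ne⟩

lemma exists_genMoment_ne_top [IsFiniteMeasure μ] (hX : Measurable X) (h : HasTailMoment μ α X)
    (x : ℝ) : ∃ l : ℝ, 0 < l ∧ genMoment μ α X x l ≠ ∞ := by
  rcases eq_or_ne α ∞ with rfl | h1
  · have h' : (expMomentSet μ X).Nonempty := by simpa [HasTailMoment] using h
    obtain ⟨l, hl, hfin⟩ := h'
    exact ⟨l, hl, mt (genMoment_top_left_eq_top_iff x l).1 hfin.ne⟩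
  · exact ⟨1, one_pos, genMoment_ne_top hX h h1 x one_pos⟩

/-- Unless α = 0, let l → 0 and use h_α(0) = 1. One finite moment, plus the constant 1, dominates
those with smaller l. -/
lemma tailBound_le_one [IsProbabilityMeasure μ] (hX : Measurable X) (h : HasTailMoment μ α X)
    (x : ℝ) : tailBound μ α X x ≤ 1 := by
  rcases eq_or_ne α 0 with rfl | h0
  · rw [tailBound_zero_left hX]
    exact prob_le_one
  obtain ⟨l, hl, hfin⟩ := exists_genMoment_ne_top hX h x
  have hdiv : Tendsto (fun n : ℕ => l / ((n : ℝ) + 1)) atTop (𝓝 0) :=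
    (tendsto_const_nhds (x := l)).div_atTop
      (tendsto_atTop_add_const_right _ _ tendsto_natCast_atTop_atTop)
  have hlim : Tendsto (fun n : ℕ => genMoment μ α X x (l / ((n : ℝ) + 1))) atTop
      (𝓝 (∫⁻ _, 1 ∂μ)) := by
    refine tendsto_lintegral_of_dominated_convergence
      (fun ω => 1 + ENNReal.ofReal (hFun α (l * (X ω - x))))
      (fun n => measurable_ofReal_hFun hX α x _) (fun n => ?_) ?_ ?_
    · refine Eventually.of_forall fun ω => ?_
      rcases le_total (X ω - x) 0 with hω | hω
      · refine le_trans ?_ le_self_add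
        exact ENNReal.ofReal_le_one.2
          (hFun_le_one α (mul_nonpos_of_nonneg_of_nonpos (by positivity) hω))
      · refine le_trans ?_ le_add_self
        refine ENNReal.ofReal_le_ofReal (hFun_monotone α ?_)
        gcongr
        exact div_le_self hl.le (by linarith [(n.cast_nonneg : (0 : ℝ) ≤ n)])
    · rw [lintegral_add_left measurable_const]
      simpa [genMoment] using hfin
    · refine Eventually.of_forall fun ω => ?_
      have := tendsto_hFun (tendsto_const_nhds (x := α)) h0 (hdiv.mul_const (X ω - x))
      rw [zero_mul, hFun_apply_zero] at this
      simpa using ENNReal.tendsto_ofReal this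
  simp only [lintegral_const, measure_univ, mul_one] at hlim
  exact ge_of_tendsto' hlim fun n => tailBound_le_genMoment x (by positivity)

/-- When X ≤ x almost surely and α ≠ 0, h_α(l(X - x)) ≤ 1 tends to the indicator of X = x as l → ∞.
-/
lemma tailBound_eq_of_ae_le [IsFiniteMeasure μ] (hX : Measurable X) {x : ℝ}
    (h : ∀ᵐ ω ∂μ, X ω ≤ x) : tailBound μ α X x = μ {ω | X ω = x} := by
  have hae : ({ω | x ≤ X ω} : Set Ω) =ᵐ[μ] ({ω | X ω = x} : Set Ω) := by
    filter_upwards [h] with ω hω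
    exact propext ⟨fun hx => le_antisymm hω hx, fun hx => hx.ge⟩
  have hs : MeasurableSet {ω | X ω = x} := measurableSet_eq_fun hX measurable_const
  refine le_antisymm ?_ ((measure_congr hae).ge.trans (measure_le_tailBound hX x))
  rcases eq_or_ne α 0 with rfl | h0
  · rw [tailBound_zero_left hX, measure_congr hae]
  have hnat : Tendsto (fun n : ℕ => (n : ℝ) + 1) atTop atTop :=
    tendsto_atTop_add_const_right _ _ tendsto_natCast_atTop_atTop
  have hlim : Tendsto (fun n : ℕ => genMoment μ α X x ((n : ℝ) + 1)) atTop
      (𝓝 (∫⁻ ω, {ω | X ω = x}.indicator 1 ω ∂μ)) := by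
    refine tendsto_lintegral_of_dominated_convergence (fun _ => 1)
      (fun n => measurable_ofReal_hFun hX α x _) (fun n => ?_) (by simp) ?_
    · filter_upwards [h] with ω hω
      exact ENNReal.ofReal_le_one.2
        (hFun_le_one α (mul_nonpos_of_nonneg_of_nonpos (by positivity) (by linarith)))
    · filter_upwards [h] with ω hω
      rcases hω.eq_or_lt with heq | hlt
      · simp [heq, hFun_apply_zero]
      · rw [Set.indicator_of_notMem (show ω ∉ {ω | X ω = x} from hlt.ne)]
        have : Tendsto (fun n : ℕ => hFun α (((n : ℝ) + 1) * (X ω - x))) atTop (𝓝 0) :=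
          tendsto_hFun_atBot.comp (hnat.atTop_mul_const_of_neg (by linarith))
        simpa using ENNReal.tendsto_ofReal this
  rw [lintegral_indicator_one hs] at hlim
  exact ge_of_tendsto' hlim fun n => tailBound_le_genMoment x (by positivity)

lemma tailBound_const [IsProbabilityMeasure μ] (α : ℝ≥0∞) (c x : ℝ) :
    tailBound μ α (fun _ => c) x = if x ≤ c then 1 else 0 := by
  rcases lt_trichotomy x c with h | rfl | h
  · rw [if_pos h.le]
    refine le_antisymm (tailBound_le_one measurable_const ?_ x) ?_
    · unfold HasTailMoment
      split_ifs
      · exact ⟨1, one_pos, by simp⟩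
      · simp
    · simpa [h.le] using measure_le_tailBound (μ := μ) (α := α) (measurable_const (a := c)) x
  · rw [tailBound_eq_of_ae_le measurable_const (by simp)]
    simp
  · rw [tailBound_eq_of_ae_le measurable_const (by simp [h.le])]
    simp [h.ne, h]

lemma tailBound_add_const (c x : ℝ) :
    tailBound μ α (fun ω => X ω + c) (x + c) = tailBound μ α X x := by
  simp [tailBound, genMoment]

lemma tailBound_const_mul {κ : ℝ} (hκ : 0 < κ) (x : ℝ) :
    tailBound μ α (fun ω => κ * X ω) (κ * x) = tailBound μ α X x := by
  have e : ∀ l, genMoment μ α (fun ω => κ * X ω) (κ * x) l = genMoment μ α X x (l * κ) := by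
    intro l
    simp only [genMoment, ← mul_sub, mul_assoc]
  refine le_antisymm (le_tailBound_iff.2 fun l hl => ?_) (le_tailBound_iff.2 fun l hl => ?_)
  · refine (tailBound_le_genMoment _ (div_pos hl hκ)).trans_eq ?_
    rw [e, div_mul_cancel₀ _ hκ.ne']
  · rw [e]
    exact tailBound_le_genMoment _ (mul_pos hl hκ)

lemma measure_lt_pos_of_lt_xStar (hX : Measurable X) {x : ℝ} (h : (x : EReal) < xStar μ X) :
    0 < μ {ω | x < X ω} := by
  obtain ⟨_, ⟨r, hr, rfl⟩, hxr⟩ := lt_sSup_iff.1 h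
  have := (Measure.mem_support_iff_forall r).1 hr (Set.Ioi x)
    (Ioi_mem_nhds (EReal.coe_lt_coe_iff.1 hxr))
  rwa [Measure.map_apply hX measurableSet_Ioi] at this

lemma ae_le_of_xStar_le (hX : Measurable X) {x : ℝ} (h : xStar μ X ≤ x) :
    ∀ᵐ ω ∂μ, X ω ≤ x := by
  have h1 : ∀ᵐ ω ∂μ, X ω ∈ (μ.map X).support :=
    ae_of_ae_map hX.aemeasurable Measure.support_mem_ae
  filter_upwards [h1] with ω hω
  exact EReal.coe_le_coe_iff.1 ((le_sSup (Set.mem_image_of_mem _ hω)).trans h)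

lemma measure_eq_zero_of_xStar_lt (hX : Measurable X) {x : ℝ} (h : xStar μ X < x) :
    μ {ω | X ω = x} = 0 := by
  obtain ⟨y, h1, h2⟩ := EReal.lt_iff_exists_real_btwn.1 h
  have h2' : y < x := EReal.coe_lt_coe_iff.1 h2
  have : ∀ᵐ ω ∂μ, ¬ X ω = x := by
    filter_upwards [ae_le_of_xStar_le hX h1.le] with ω hω
    exact (hω.trans_lt h2').ne
  simpa [ae_iff] using this

lemma pStar_eq {x : ℝ} (h : (x : EReal) = xStar μ X) : pStar μ X = μ {ω | X ω = x} := by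
  simp only [pStar, ← h, EReal.coe_eq_coe_iff]

end TailBoundBasics

/-! ### Concavity in the threshold. -/

section Concavity

variable {Ω : Type*} [MeasurableSpace Ω] {μ : Measure Ω} {X : Ω → ℝ} {α : ℝ≥0∞}

lemma ENNReal.rpow_le_rpow_of_nonpos_exponent {x y : ℝ≥0∞} {q : ℝ} (h : x ≤ y) (hq : q ≤ 0) :
    y ^ q ≤ x ^ q := by
  rw [← neg_neg q, ENNReal.rpow_neg y, ENNReal.rpow_neg x, ENNReal.inv_le_inv]
  exact ENNReal.rpow_le_rpow h (by linarith)

/-- The expectation `E h_α(l(X - x))` to the power `-1/α` is affine in `x` for a fixed value `t`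
of `x - α / l`. -/
lemma genMoment_rpow_eq (h0 : α ≠ 0) (h1 : α ≠ ∞) {x t : ℝ} (ht : t < x) :
    (genMoment μ α X x (α.toReal / (x - t))) ^ (-1 / α.toReal) = ENNReal.ofReal (x - t) *
      (∫⁻ ω, ENNReal.ofReal (gFun α t (X ω)) ∂μ) ^ (-1 / α.toReal) := by
  have hp := ENNReal.toReal_pos h0 h1
  have hx : 0 < x - t := by linarith
  rw [genMoment_eq_gFun h0 h1 x (div_pos hp hx)]
  have e1 : x - α.toReal / (α.toReal / (x - t)) = t := by
    rw [div_div_cancel₀ hp.ne']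
    ring
  have e2 : α.toReal / (x - t) / α.toReal = (x - t)⁻¹ := by
    field_simp
  have hpos : 0 < ((x - t)⁻¹) ^ α.toReal := by positivity
  have hpos' : ENNReal.ofReal (((x - t)⁻¹) ^ α.toReal) ≠ 0 := by
    rwa [Ne, ENNReal.ofReal_eq_zero, not_le]
  rw [e1, e2, ENNReal.mul_rpow_eq_ite, if_neg (by simp [hpos', ENNReal.ofReal_ne_top]),
    ENNReal.ofReal_rpow_of_pos hpos, ← Real.rpow_mul (by positivity),
    mul_div_cancel₀ _ hp.ne', Real.rpow_neg_one, inv_inv]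

/-- The trivial range t ≥ x is included because t below a convex combination of two thresholds may
still exceed one of them. -/
lemma ofReal_sub_mul_le_tailBound_rpow (h0 : α ≠ 0) (h1 : α ≠ ∞) (x t : ℝ) :
    ENNReal.ofReal (x - t) * (∫⁻ ω, ENNReal.ofReal (gFun α t (X ω)) ∂μ) ^ (-1 / α.toReal) ≤
      (tailBound μ α X x) ^ (-1 / α.toReal) := by
  have hp := ENNReal.toReal_pos h0 h1
  rcases le_or_gt x t with h | h
  · rw [ENNReal.ofReal_of_nonpos (by linarith), zero_mul]
    exact zero_le
  rw [← genMoment_rpow_eq h0 h1 h]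
  exact ENNReal.rpow_le_rpow_of_nonpos_exponent
    (tailBound_le_genMoment x (div_pos hp (by linarith)))
    (div_nonpos_of_nonpos_of_nonneg (by norm_num) hp.le)

lemma convexOn_tailBound_rpow (h0 : α ≠ 0) (h1 : α ≠ ∞) :
    ConvexOn ℝ≥0 Set.univ (fun x : ℝ => (tailBound μ α X x) ^ (-1 / α.toReal)) := by
  have hp := ENNReal.toReal_pos h0 h1
  refine ⟨convex_univ, fun x _ y _ a b _ _ hab => ?_⟩
  set R := a • (tailBound μ α X x) ^ (-1 / α.toReal) + b • (tailBound μ α X y) ^ (-1 / α.toReal)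
    with hR
  set z : ℝ := a • x + b • y with hz
  have hab' : (a : ℝ) + b = 1 := by exact_mod_cast hab
  -- Undoing the decreasing power turns the claim into a lower bound on an infimum, checked for each
  -- l. With t = z - α/l it follows from z - t = a(x - t) + b(y - t) and subadditivity of the
  -- positive part.
  have key : R ^ (-α.toReal) ≤ tailBound μ α X z := by
    refine le_tailBound_iff.2 fun l hl => ?_
    set t := z - α.toReal / l with ht
    have htz : t < z := by
      have : 0 < α.toReal / l := by positivity
      linarith
    have hl' : l = α.toReal / (z - t) := by
      rw [ht, sub_sub_cancel, div_div_cancel₀ hp.ne']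
    have hle : (genMoment μ α X z l) ^ (-1 / α.toReal) ≤ R := by
      rw [hl', genMoment_rpow_eq h0 h1 htz]
      set N := (∫⁻ ω, ENNReal.ofReal (gFun α t (X ω)) ∂μ) ^ (-1 / α.toReal)
      calc ENNReal.ofReal (z - t) * N
          ≤ (a * ENNReal.ofReal (x - t) + b * ENNReal.ofReal (y - t)) * N := by
            gcongr
            rw [← ENNReal.ofReal_coe_nnreal (p := a), ← ENNReal.ofReal_coe_nnreal (p := b),
              ← ENNReal.ofReal_mul a.coe_nonneg, ← ENNReal.ofReal_mul b.coe_nonneg]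
            refine le_trans (ENNReal.ofReal_le_ofReal (le_of_eq ?_)) ENNReal.ofReal_add_le
            rw [hz, NNReal.smul_def, NNReal.smul_def, smul_eq_mul, smul_eq_mul]
            linear_combination t * hab'
        _ = a * (ENNReal.ofReal (x - t) * N) + b * (ENNReal.ofReal (y - t) * N) := by ring
        _ ≤ R := by
            rw [hR, ENNReal.smul_def, ENNReal.smul_def, smul_eq_mul, smul_eq_mul]
            gcongr <;> exact ofReal_sub_mul_le_tailBound_rpow h0 h1 _ _
    have := ENNReal.rpow_le_rpow_of_nonpos_exponent hle (q := -α.toReal) (by linarith)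
    rwa [← ENNReal.rpow_mul, show -1 / α.toReal * -α.toReal = 1 by field_simp,
      ENNReal.rpow_one] at this
  have := ENNReal.rpow_le_rpow_of_nonpos_exponent key (q := -1 / α.toReal)
    (div_nonpos_of_nonpos_of_nonneg (by norm_num) hp.le)
  rwa [← ENNReal.rpow_mul, show -α.toReal * (-1 / α.toReal) = 1 by field_simp,
    ENNReal.rpow_one] at this

/-- For fixed l the moment is e^{-lx} times a factor free of x, so weighted geometric means of
moments are exact. -/
lemma tailBound_top_rpow_mul_le (x y : ℝ) {a b : ℝ} (ha : 0 ≤ a) (hb : 0 ≤ b) (hab : a + b = 1) :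
    (tailBound μ ∞ X x) ^ a * (tailBound μ ∞ X y) ^ b ≤ tailBound μ ∞ X (a * x + b * y) := by
  refine le_tailBound_iff.2 fun l hl => ?_
  calc (tailBound μ ∞ X x) ^ a * (tailBound μ ∞ X y) ^ b
      ≤ (genMoment μ ∞ X x l) ^ a * (genMoment μ ∞ X y l) ^ b := by
        gcongr <;> exact tailBound_le_genMoment _ hl
    _ = genMoment μ ∞ X (a * x + b * y) l := by
        simp only [genMoment_top_left]
        set M := ∫⁻ ω, ENNReal.ofReal (Real.exp (l * X ω)) ∂μ
        rw [ENNReal.mul_rpow_of_nonneg _ _ ha, ENNReal.mul_rpow_of_nonneg _ _ hb,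
          ENNReal.ofReal_rpow_of_pos (Real.exp_pos _), ENNReal.ofReal_rpow_of_pos (Real.exp_pos _),
          mul_mul_mul_comm, ← ENNReal.rpow_add_of_nonneg _ _ ha hb, hab, ENNReal.rpow_one,
          ← ENNReal.ofReal_mul (by positivity), ← Real.exp_mul, ← Real.exp_mul, ← Real.exp_add]
        congr 3
        ring

lemma log_tailBound_top_concave (x y : ℝ) {a b : ℝ} (ha : 0 ≤ a) (hb : 0 ≤ b) (hab : a + b = 1) :
    (a : EReal) * ENNReal.log (tailBound μ ∞ X x) + (b : EReal) * ENNReal.log (tailBound μ ∞ X y)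
      ≤ ENNReal.log (tailBound μ ∞ X (a * x + b * y)) := by
  rw [← ENNReal.log_rpow, ← ENNReal.log_rpow, ← ENNReal.log_mul_add]
  exact ENNReal.log_monotone (tailBound_top_rpow_mul_le x y ha hb hab)

end Concavity

/-- Upper semicontinuity reduces to that of generalized moments, and lower semicontinuity is
automatic to the left of `x_*`. -/
lemma tendsto_tailBound_of_genMoment {Ω : Type*} [MeasurableSpace Ω] {μ : Measure Ω}
    {Ωs : ℕ → Type*} [∀ n, MeasurableSpace (Ωs n)] {μs : ∀ n, Measure (Ωs n)} {X : Ω → ℝ}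
    {Xs : ∀ n, Ωs n → ℝ} {α : ℝ≥0∞} {αs : ℕ → ℝ≥0∞} {xs : ℕ → ℝ} {x : ℝ}
    (hup : ∀ l : ℝ, 0 < l → ∀ c, genMoment μ α X x l < c →
      ∀ᶠ n in atTop, genMoment (μs n) (αs n) (Xs n) (xs n) l < c)
    (hlow : ∀ c < tailBound μ α X x, ∀ᶠ n in atTop,
      c ≤ tailBound (μs n) (αs n) (Xs n) (xs n)) :
    Tendsto (fun n => tailBound (μs n) (αs n) (Xs n) (xs n)) atTop (𝓝 (tailBound μ α X x)) := by
  refine tendsto_order.2 ⟨fun c hc => ?_, fun c hc => ?_⟩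
  · obtain ⟨d, hcd, hd⟩ := exists_between hc
    filter_upwards [hlow d hd] with n hn
    exact hcd.trans_le hn
  · obtain ⟨l, hl, hlc⟩ := tailBound_lt_iff.1 hc
    filter_upwards [hup l hl c hlc] with n hn
    exact tailBound_lt_iff.2 ⟨l, hl, hn⟩

/-! ### Lower semicontinuity; stability in the threshold and in the order. -/

section Stability

variable {Ω : Type*} [MeasurableSpace Ω] {μ : Measure Ω} [IsProbabilityMeasure μ]
  {Ωs : ℕ → Type*} [∀ n, MeasurableSpace (Ωs n)] {μs : ∀ n, Measure (Ωs n)}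
  [∀ n, IsProbabilityMeasure (μs n)] {X : Ω → ℝ} {Xs : ∀ n, Ωs n → ℝ} {α : ℝ≥0∞}

lemma MeasureTheory.TendstoInDistribution.le_liminf_measure_preimage (hX : Measurable X)
    (hXs : ∀ n, Measurable (Xs n)) (h : TendstoInDistribution Xs atTop X μs μ) {G : Set ℝ}
    (hG : IsOpen G) : μ (X ⁻¹' G) ≤ liminf (fun n => μs n (Xs n ⁻¹' G)) atTop := by
  have := ProbabilityMeasure.le_liminf_measure_open_of_tendsto h.tendsto hG
  simp only [ProbabilityMeasure.coe_mk] at this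
  rw [Measure.map_apply hX hG.measurableSet] at this
  simpa only [Measure.map_apply (hXs _) hG.measurableSet] using this

lemma MeasureTheory.TendstoInDistribution.comp_strictMono (h : TendstoInDistribution Xs atTop X μs μ)
    {φ : ℕ → ℕ} (hφ : StrictMono φ) :
    TendstoInDistribution (fun n => Xs (φ n)) atTop X (fun n => μs (φ n)) μ where
  forall_aemeasurable n := h.forall_aemeasurable (φ n)
  aemeasurable_limit := h.aemeasurable_limit
  tendsto := h.tendsto.comp hφ.tendsto_atTop

/-- A version of Fatou's lemma for monotone functions under convergence in distribution. -/
lemma MeasureTheory.TendstoInDistribution.lintegral_le_liminf_of_monotone (hX : Measurable X)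
    (hXs : ∀ n, Measurable (Xs n)) (h : TendstoInDistribution Xs atTop X μs μ)
    {fs : ℕ → ℝ → ℝ} {f : ℝ → ℝ} (hfs : ∀ n, Monotone (fs n)) (hf : Measurable f)
    (hfs0 : ∀ n u, 0 ≤ fs n u) (hf0 : ∀ u, 0 ≤ f u)
    (hlim : ∀ u s : ℝ, s < f u → ∃ c < u, ∀ᶠ n in atTop, s < fs n c) :
    ∫⁻ ω, ENNReal.ofReal (f (X ω)) ∂μ ≤
      liminf (fun n => ∫⁻ ω, ENNReal.ofReal (fs n (Xs n ω)) ∂(μs n)) atTop := by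
  -- Layer-cake formula: Fatou in the level s leaves a comparison of the probabilities of superlevel
  -- sets.
  simp_rw [fun n => lintegral_eq_lintegral_meas_lt (μs n)
    (Eventually.of_forall fun ω => hfs0 n (Xs n ω))
    (((hfs n).measurable.comp (hXs n)).aemeasurable)]
  rw [lintegral_eq_lintegral_meas_lt μ (Eventually.of_forall fun ω => hf0 (X ω))
    ((hf.comp hX).aemeasurable)]
  refine le_trans (lintegral_mono fun s => ?_) (lintegral_liminf_le fun n => Antitone.measurable
    fun s s' hs => measure_mono fun ω hω => lt_of_le_of_lt hs hω)
  -- The half-lines (c, ∞) with c in C cover {f > s}. By Lindelöf countably many suffice, and being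
  -- nested they reduce the claim to the portmanteau inequality for one half-line.
  set C : Set ℝ := {c | ∀ᶠ n in atTop, s < fs n c} with hC
  obtain ⟨T, hTC, hT, hTU⟩ := TopologicalSpace.isOpen_biUnion_countable C (fun c => Set.Ioi c)
    (fun c _ => isOpen_Ioi)
  have hsub : {ω | s < f (X ω)} ⊆ ⋃ c ∈ T, X ⁻¹' (Set.Ioi c) := by
    intro ω hω
    obtain ⟨c, hcu, hc⟩ := hlim (X ω) s hω
    have : X ω ∈ ⋃ c ∈ T, Set.Ioi c := by
      rw [hTU]
      exact Set.mem_biUnion (show c ∈ C from hc) hcu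
    simpa using this
  refine (measure_mono hsub).trans ?_
  rw [measure_biUnion_eq_iSup hT]
  · refine iSup₂_le fun c hc => ?_
    refine (h.le_liminf_measure_preimage hX hXs isOpen_Ioi).trans ?_
    refine liminf_le_liminf ?_
    filter_upwards [hTC hc] with n hn
    exact measure_mono fun ω hω => hn.trans_le (hfs n (le_of_lt hω))
  · intro c hc d hd
    rcases le_total c d with hcd | hcd
    · exact ⟨c, hc, subset_rfl, Set.preimage_mono (Set.Ioi_subset_Ioi hcd)⟩
    · exact ⟨d, hd, Set.preimage_mono (Set.Ioi_subset_Ioi hcd), subset_rfl⟩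

/-- The point is l = 0, a possible limit of parameters: there the moment equals 1. -/
lemma le_genMoment_of_nonneg {x l : ℝ} {c : ℝ≥0∞} (hl : 0 ≤ l) (h1 : tailBound μ α X x ≤ 1)
    (hc : c < tailBound μ α X x) : c < genMoment μ α X x l := by
  refine hc.trans_le ?_
  rcases hl.eq_or_lt with rfl | hl
  · refine h1.trans_eq ?_
    simp [genMoment, hFun_apply_zero]
  · exact tailBound_le_genMoment x hl

/-- Joint lower semicontinuity of the tail bound in the order, the variable and the threshold. -/
lemma eventually_le_tailBound (hX : Measurable X) (hXs : ∀ n, Measurable (Xs n))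
    (h : TendstoInDistribution Xs atTop X μs μ) {αs : ℕ → ℝ≥0∞} (hα : Tendsto αs atTop (𝓝 α))
    (h0 : α ≠ 0) {xs : ℕ → ℝ} {x : ℝ} (hx : Tendsto xs atTop (𝓝 x))
    (hpos : 0 < μ {ω | x < X ω}) (h1 : tailBound μ α X x ≤ 1) {c : ℝ≥0∞}
    (hc : c < tailBound μ α X x) :
    ∀ᶠ n in atTop, c ≤ tailBound (μs n) (αs n) (Xs n) (xs n) := by
  by_contra hcon
  obtain ⟨φ, hφ, hφc⟩ := extraction_of_frequently_atTop (not_eventually.1 hcon)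
  simp only [not_le, tailBound_lt_iff] at hφc
  choose ls hls hlc using hφc
  -- Embedding the parameters in [0, ∞] makes a subsequence converge.
  obtain ⟨L, ψ, hψ, hL⟩ := CompactSpace.tendsto_subseq (fun n => ENNReal.ofReal (ls n))
  have hα' : Tendsto (fun n => αs (φ (ψ n))) atTop (𝓝 α) :=
    hα.comp (hφ.comp hψ).tendsto_atTop
  have hx' : Tendsto (fun n => xs (φ (ψ n))) atTop (𝓝 x) :=
    hx.comp (hφ.comp hψ).tendsto_atTop
  have hfatou : ∀ f : ℝ → ℝ, Measurable f → (∀ u, 0 ≤ f u) →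
      (∀ u s : ℝ, s < f u → ∃ v < u, ∀ᶠ n in atTop,
        s < hFun (αs (φ (ψ n))) (ls (ψ n) * (v - xs (φ (ψ n))))) →
      ∫⁻ ω, ENNReal.ofReal (f (X ω)) ∂μ ≤ c := by
    intro f hf hf0 hlim
    refine ((h.comp_strictMono (hφ.comp hψ)).lintegral_le_liminf_of_monotone hX
      (fun n => hXs (φ (ψ n))) (fun n u v huv => ?_) hf
      (fun n u => hFun_nonneg _ _) hf0 hlim).trans ?_
    · have := (hls (ψ n)).le
      exact hFun_monotone _ (by gcongr)
    · exact liminf_le_of_frequently_le' (Frequently.of_forall fun n => (hlc (ψ n)).le)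
  rcases eq_or_ne L ∞ with rfl | hL1
  · have hls' : Tendsto (fun n => ls (ψ n)) atTop atTop := ENNReal.tendsto_ofReal_nhds_top.1 hL
    -- A fixed order γ in (0, α) eventually lies below all the orders, so divergence of h_γ is
    -- enough.
    obtain ⟨γ, hγ0, hγ⟩ := exists_between (pos_iff_ne_zero.2 h0)
    have hbig : ∀ v, x < v → Tendsto (fun n =>
        hFun (αs (φ (ψ n))) (ls (ψ n) * (v - xs (φ (ψ n))))) atTop atTop := by
      intro v hv
      refine tendsto_atTop_mono' _ ?_ ((tendsto_hFun_atTop hγ0.ne').comp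
        (hls'.atTop_mul_pos (sub_pos.2 hv) (tendsto_const_nhds.sub hx')))
      filter_upwards [hα'.eventually (lt_mem_nhds hγ)] with n hn
      exact hFun_monotone_left _ hn.le
    -- Fatou with K times the indicator of u > x; letting K → ∞ forces c = ∞.
    have hK : ∀ K : ℝ, 0 ≤ K → ENNReal.ofReal K * μ {ω | x < X ω} ≤ c := by
      intro K hK
      have hs : MeasurableSet {ω | x < X ω} := measurableSet_lt measurable_const hX
      refine le_trans (le_of_eq ?_) (hfatou (fun u => if x < u then K else 0)
        (Measurable.ite measurableSet_Ioi measurable_const measurable_const)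
        (fun u => by split_ifs <;> simp [hK]) ?_)
      · rw [← lintegral_indicator_const hs]
        refine lintegral_congr fun ω => ?_
        by_cases hω : x < X ω
        · rw [Set.indicator_of_mem (show ω ∈ {ω | x < X ω} from hω), if_pos hω]
        · rw [Set.indicator_of_notMem (show ω ∉ {ω | x < X ω} from hω), if_neg hω,
            ENNReal.ofReal_zero]
      · intro u s hsu
        by_cases hu : x < u
        · obtain ⟨v, hxv, hvu⟩ := exists_between hu
          exact ⟨v, hvu, (hbig v hxv).eventually_gt_atTop s⟩
        · rw [if_neg hu] at hsu
          exact ⟨u - 1, by linarith, Eventually.of_forall fun n => hsu.trans_le (hFun_nonneg _ _)⟩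
    have hct : c ≠ ∞ := hc.ne_top
    have hm : μ {ω | x < X ω} ≠ ∞ := measure_ne_top _ _
    have hlim : Tendsto (fun n : ℕ => ENNReal.ofReal n * μ {ω | x < X ω}) atTop (𝓝 ∞) := by
      have : Tendsto (fun n : ℕ => ENNReal.ofReal (n : ℝ)) atTop (𝓝 ∞) :=
        ENNReal.tendsto_ofReal_nhds_top.2 tendsto_natCast_atTop_atTop
      have h2 := ENNReal.Tendsto.mul_const (b := μ {ω | x < X ω}) this (Or.inl ENNReal.top_ne_zero)
      rwa [ENNReal.top_mul hpos.ne'] at h2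
    exact hct (top_le_iff.1 (le_of_tendsto' hlim fun n => hK n n.cast_nonneg))
  · have hls' : Tendsto (fun n => ls (ψ n)) atTop (𝓝 L.toReal) := by
      refine ((ENNReal.tendsto_toReal hL1).comp hL).congr fun n => ?_
      exact ENNReal.toReal_ofReal (hls (ψ n)).le
    have hcont : Continuous fun u : ℝ => hFun α (L.toReal * (u - x)) :=
      (continuous_hFun h0).comp (by fun_prop)
    refine (le_genMoment_of_nonneg (l := L.toReal) ENNReal.toReal_nonneg h1 hc).not_ge
      (hfatou _ hcont.measurable (fun u => hFun_nonneg _ _) fun u s hsu => ?_)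
    obtain ⟨v, hv, hvu⟩ := ((hcont.continuousWithinAt (s := Set.Iio u)).eventually
      (lt_mem_nhds hsu) |>.and self_mem_nhdsWithin).exists
    refine ⟨v, hvu, ?_⟩
    exact (tendsto_hFun hα' h0 (hls'.mul (tendsto_const_nhds.sub hx'))).eventually (lt_mem_nhds hv)

lemma tendsto_tailBound_threshold (hX : Measurable X) (h : HasTailMoment μ α X) (h0 : α ≠ 0)
    {x : ℝ} (hne : ¬ ((x : EReal) = xStar μ X ∧ 0 < pStar μ X)) {xs : ℕ → ℝ}
    (hx : Tendsto xs atTop (𝓝 x)) :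
    Tendsto (fun n => tailBound μ α X (xs n)) atTop (𝓝 (tailBound μ α X x)) := by
  refine tendsto_tailBound_of_genMoment (μs := fun _ => μ) (Xs := fun _ => X)
    (αs := fun _ => α) ?_ ?_
  · intro l hl c hc
    -- The moment at threshold x - 1 dominates those at nearby thresholds. For α = ∞, changing the
    -- threshold only multiplies the moment by a positive constant.
    have hfin : genMoment μ α X (x - 1) l ≠ ∞ := by
      rcases eq_or_ne α ∞ with rfl | h1
      · refine mt (genMoment_top_left_eq_top_iff _ _).1 ?_
        exact mt (genMoment_top_left_eq_top_iff x l).2 hc.ne_top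
      · exact genMoment_ne_top hX h h1 _ hl
    have hlim : Tendsto (fun n => genMoment μ α X (xs n) l) atTop (𝓝 (genMoment μ α X x l)) := by
      refine tendsto_lintegral_filter_of_dominated_convergence
        (fun ω => ENNReal.ofReal (hFun α (l * (X ω - (x - 1)))))
        (Eventually.of_forall fun n => measurable_ofReal_hFun hX _ _ _) ?_ hfin
        (Eventually.of_forall fun ω => ENNReal.tendsto_ofReal
          (tendsto_hFun tendsto_const_nhds h0
            (tendsto_const_nhds.mul (tendsto_const_nhds.sub hx))))
      filter_upwards [hx.eventually (lt_mem_nhds (sub_one_lt x))] with n hn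
      exact Eventually.of_forall fun ω => ENNReal.ofReal_le_ofReal
        (hFun_monotone α (by gcongr))
    exact hlim.eventually (gt_mem_nhds hc)
  · intro c hc
    rcases lt_or_ge (x : EReal) (xStar μ X) with hlt | hge
    · exact eventually_le_tailBound hX (fun _ => hX) (tendstoInDistribution_const hX.aemeasurable)
        tendsto_const_nhds h0 hx (measure_lt_pos_of_lt_xStar hX hlt) (tailBound_le_one hX h x) hc
    · rw [tailBound_eq_of_ae_le hX (ae_le_of_xStar_le hX hge)] at hc
      have hz : μ {ω | X ω = x} = 0 := by
        rcases hge.eq_or_lt with heq | hlt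
        · rw [← pStar_eq heq.symm]
          by_contra hp
          exact hne ⟨heq.symm, pos_iff_ne_zero.2 hp⟩
        · exact measure_eq_zero_of_xStar_lt hX hlt
      simp [hz] at hc

lemma continuousAt_tailBound_iff (hX : Measurable X) (h : HasTailMoment μ α X) (h0 : α ≠ 0)
    (x : ℝ) : ContinuousAt (fun y : ℝ => tailBound μ α X y) x ↔
      ¬ ((x : EReal) = xStar μ X ∧ 0 < pStar μ X) := by
  refine ⟨?_, fun hne => tendsto_of_seq_tendsto fun xs hxs =>
    tendsto_tailBound_threshold hX h h0 hne hxs⟩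
  rintro hcont ⟨heq, hp⟩
  rw [pStar_eq heq] at hp
  -- Beyond x_* the bound is zero, whereas at x_* it equals p_* > 0.
  have hright : Tendsto (fun y : ℝ => tailBound μ α X y) (𝓝[>] x) (𝓝 0) := by
    refine tendsto_const_nhds.congr' ?_
    filter_upwards [self_mem_nhdsWithin] with y hy
    have hy' : xStar μ X < y := by
      rw [← heq]
      exact EReal.coe_lt_coe_iff.2 hy
    rw [tailBound_eq_of_ae_le hX (ae_le_of_xStar_le hX hy'.le),
      measure_eq_zero_of_xStar_lt hX hy']
  have hzero := tendsto_nhds_unique (hcont.tendsto.mono_left nhdsWithin_le_nhds) hright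
  rw [tailBound_eq_of_ae_le hX (ae_le_of_xStar_le hX heq.ge)] at hzero
  exact hp.ne' hzero

lemma tendsto_tailBound_order (hX : Measurable X) {αs : ℕ → ℝ≥0}
    (hα : Tendsto (fun n => (αs n : ℝ≥0∞)) atTop (𝓝 α))
    (h : HasTailMoment μ (⨆ n, (αs n : ℝ≥0∞)) X) (x : ℝ) :
    Tendsto (fun n => tailBound μ (αs n : ℝ≥0∞) X x) atTop (𝓝 (tailBound μ α X x)) := by
  set β := ⨆ n, (αs n : ℝ≥0∞) with hβ
  have hαβ : α ≤ β := le_of_tendsto' hα fun n => le_iSup (fun n => (αs n : ℝ≥0∞)) n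
  -- A sequence of finite orders with a finite limit is bounded. So if β = ∞, the dominating moment
  -- is the limiting one, finite wherever the upper bound is claimed.
  have htop : β = ∞ → α = ∞ := by
    intro hβ1
    by_contra hα1
    have hbdd : ∃ M : ℝ≥0, ∀ n, αs n ≤ M := by
      lift α to ℝ≥0 using hα1
      obtain ⟨M, hM⟩ := (ENNReal.tendsto_coe.1 hα).bddAbove_range
      exact ⟨M, fun n => hM ⟨n, rfl⟩⟩
    obtain ⟨M, hM⟩ := hbdd
    have : β ≤ M := iSup_le fun n => ENNReal.coe_le_coe.2 (hM n)
    exact absurd (this.trans_lt ENNReal.coe_lt_top) (by simp [hβ1])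
  refine tendsto_tailBound_of_genMoment (μs := fun _ => μ) (Xs := fun _ => X)
    (xs := fun _ => x) ?_ ?_
  · intro l hl c hc
    have hfin : genMoment μ β X x l ≠ ∞ := by
      rcases eq_or_ne β ∞ with hβ1 | hβ1
      · rw [htop hβ1] at hc
        rw [hβ1]
        exact hc.ne_top
      · exact genMoment_ne_top hX h hβ1 x hl
    have hlim : Tendsto (fun n => genMoment μ (αs n) X x l) atTop (𝓝 (genMoment μ α X x l)) :=
      tendsto_lintegral_of_dominated_convergence
        (fun ω => ENNReal.ofReal (hFun β (l * (X ω - x))))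
        (fun n => measurable_ofReal_hFun hX _ _ _)
        (fun n => Eventually.of_forall fun ω => ENNReal.ofReal_le_ofReal
          (hFun_monotone_left _ (le_iSup (fun n => (αs n : ℝ≥0∞)) n))) hfin
        (Eventually.of_forall fun ω => ENNReal.tendsto_ofReal (tendsto_hFun_left _ hα))
    exact hlim.eventually (gt_mem_nhds hc)
  · intro c hc
    rcases eq_or_ne α 0 with rfl | h0
    · exact Eventually.of_forall fun n => hc.le.trans (tailBound_mono_left x zero_le)
    rcases lt_or_ge (x : EReal) (xStar μ X) with hlt | hge
    · exact eventually_le_tailBound hX (fun _ => hX) (tendstoInDistribution_const hX.aemeasurable)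
        hα h0 tendsto_const_nhds (measure_lt_pos_of_lt_xStar hX hlt)
        ((tailBound_mono_left x hαβ).trans (tailBound_le_one hX h x)) hc
    · have hae := ae_le_of_xStar_le hX hge
      refine Eventually.of_forall fun n => ?_
      rw [tailBound_eq_of_ae_le hX hae] at hc ⊢
      exact hc.le

end Stability

/-! ### Stability under convergence in distribution. -/

section StabilityInDistribution

variable {Ω : Type*} [MeasurableSpace Ω] {μ : Measure Ω} {Ωs : ℕ → Type*}
  [∀ n, MeasurableSpace (Ωs n)] {μs : ∀ n, Measure (Ωs n)} {X : Ω → ℝ} {Xs : ∀ n, Ωs n → ℝ}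
  {α : ℝ≥0∞}

lemma MeasureTheory.TendstoInDistribution.tendsto_lintegral_min [IsProbabilityMeasure μ]
    [∀ n, IsProbabilityMeasure (μs n)] (hX : Measurable X) (hXs : ∀ n, Measurable (Xs n))
    (h : TendstoInDistribution Xs atTop X μs μ) {f : ℝ → ℝ} (hf : Continuous f) (K : ℝ) :
    Tendsto (fun n => ∫⁻ ω, ENNReal.ofReal (min (f (Xs n ω)) K) ∂(μs n)) atTop
      (𝓝 (∫⁻ ω, ENNReal.ofReal (min (f (X ω)) K) ∂μ)) := by
  have hc : Continuous fun u => (min (f u) K).toNNReal := by fun_prop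
  let F : BoundedContinuousFunction ℝ ℝ≥0 :=
    BoundedContinuousFunction.mkOfBound ⟨fun u => (min (f u) K).toNNReal, hc⟩ K.toNNReal (by
      intro u v
      have hle : ∀ u, (min (f u) K).toNNReal ≤ K.toNNReal :=
        fun u => Real.toNNReal_le_toNNReal (min_le_right _ _)
      have h1 : (((min (f u) K).toNNReal : ℝ≥0) : ℝ) ≤ K.toNNReal := by exact_mod_cast hle u
      have h2 : (((min (f v) K).toNNReal : ℝ≥0) : ℝ) ≤ K.toNNReal := by exact_mod_cast hle v
      rw [NNReal.dist_eq, abs_le]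
      constructor
      · simp only [ContinuousMap.coe_mk]
        linarith [(min (f u) K).toNNReal.coe_nonneg]
      · simp only [ContinuousMap.coe_mk]
        linarith [(min (f v) K).toNNReal.coe_nonneg])
  have := (ProbabilityMeasure.tendsto_iff_forall_lintegral_tendsto.1 h.tendsto) F
  simp only [ProbabilityMeasure.coe_mk] at this
  have hm : Measurable fun u => (F u : ℝ≥0∞) := F.continuous.measurable.coe_nnreal_ennreal
  rw [lintegral_map hm hX] at this
  simp only [lintegral_map hm (hXs _)] at this
  exact this

/-- For α = ∞, finiteness of the moment puts l in Λ_X. For α < ∞, the growth bound C + C u_+^α is at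
most 2C u_+^α once u ≥ 1. -/
lemma UnifIntTail.tendsto_hFun (h : UnifIntTail α μs Xs μ X) (hXs : ∀ n, Measurable (Xs n))
    (h0 : α ≠ 0) {x l : ℝ} (hl : 0 < l)
    (hfin : genMoment μ α X x l ≠ ∞) :
    Tendsto (fun N : ℝ => ⨆ n, ∫⁻ ω in {ω | N < Xs n ω},
      ENNReal.ofReal (hFun α (l * (Xs n ω - x))) ∂(μs n)) atTop (𝓝 0) := by
  suffices ∃ C : ℝ, 0 ≤ C ∧ ∃ G : ℝ → ℝ, (∀ u, 1 ≤ u → hFun α (l * (u - x)) ≤ C * G u) ∧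
      Tendsto (fun N : ℝ => ⨆ n, ∫⁻ ω in {ω | N < Xs n ω}, ENNReal.ofReal (G (Xs n ω)) ∂(μs n))
        atTop (𝓝 0) by
    obtain ⟨C, hC, G, hle, hG⟩ := this
    have hlim := ENNReal.Tendsto.const_mul (a := ENNReal.ofReal C) hG
      (Or.inr ENNReal.ofReal_ne_top)
    rw [mul_zero] at hlim
    refine tendsto_of_tendsto_of_tendsto_of_le_of_le' tendsto_const_nhds hlim
      (Eventually.of_forall fun _ => zero_le) ?_
    filter_upwards [eventually_ge_atTop 1] with N hN
    refine iSup_le fun n => ?_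
    refine le_trans ?_ (mul_le_mul_right (le_iSup _ n) _)
    rw [← lintegral_const_mul' _ _ ENNReal.ofReal_ne_top]
    refine setLIntegral_mono' (measurableSet_lt measurable_const (hXs n)) fun ω hω => ?_
    rw [← ENNReal.ofReal_mul hC]
    exact ENNReal.ofReal_le_ofReal (hle _ (hN.trans (le_of_lt hω)))
  rcases eq_or_ne α ∞ with rfl | h1
  · rw [UnifIntTail, if_pos rfl] at h
    refine ⟨Real.exp (-(l * x)), (Real.exp_pos _).le, fun u => Real.exp (l * u),
      fun u _ => le_of_eq ?_, h l ⟨hl, ?_⟩⟩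
    · rw [hFun_top_left, ← Real.exp_add]
      ring_nf
    · exact lt_top_iff_ne_top.2 (mt (genMoment_top_left_eq_top_iff x l).2 hfin)
  · rw [UnifIntTail, if_neg h1] at h
    obtain ⟨C, hC, hle⟩ := exists_hFun_le h0 h1 x hl
    refine ⟨2 * C, by positivity, fun u => (max 0 u) ^ α.toReal, fun u hu => ?_, h⟩
    refine (hle u).trans ?_
    have : 1 ≤ (max 0 u) ^ α.toReal :=
      Real.one_le_rpow (hu.trans (le_max_right _ _)) ENNReal.toReal_nonneg
    nlinarith

lemma tendsto_tailBound_of_tendstoInDistribution [IsProbabilityMeasure μ]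
    [∀ n, IsProbabilityMeasure (μs n)] (hX : Measurable X) (hXs : ∀ n, Measurable (Xs n))
    (hα : HasTailMoment μ α X) (h0 : α ≠ 0) (h : TendstoInDistribution Xs atTop X μs μ)
    (hui : UnifIntTail α μs Xs μ X) {x : ℝ}
    (hx : (x : EReal) ≠ xStar μ X ∨
      Tendsto (fun n => μs n {ω | Xs n ω = x}) atTop (𝓝 (μ {ω | X ω = x})) ∨
      μ {ω | X ω = x} = 0) :
    Tendsto (fun n => tailBound (μs n) α (Xs n) x) atTop (𝓝 (tailBound μ α X x)) := by
  refine tendsto_tailBound_of_genMoment (αs := fun _ => α) (xs := fun _ => x) ?_ ?_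
  · intro l hl c hc
    -- Budget: d for the moment truncated at level f N, which converges, and c - d for the uniformly
    -- small tail above N.
    obtain ⟨d, hgd, hdc⟩ := exists_between hc
    have hε : 0 < c - d := tsub_pos_of_lt hdc
    obtain ⟨N, hN⟩ := ((hui.tendsto_hFun hXs h0 hl hc.ne_top).eventually (gt_mem_nhds hε)).exists
    set f : ℝ → ℝ := fun u => hFun α (l * (u - x)) with hf
    have hcont : Continuous f := (continuous_hFun h0).comp (by fun_prop)
    have hmono : Monotone f := fun u v huv => hFun_monotone α (by gcongr)
    have hlim := h.tendsto_lintegral_min hX hXs hcont (f N)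
    have hlt : ∫⁻ ω, ENNReal.ofReal (min (f (X ω)) (f N)) ∂μ < d :=
      (lintegral_mono fun ω => ENNReal.ofReal_le_ofReal (min_le_left _ _)).trans_lt hgd
    filter_upwards [hlim.eventually (gt_mem_nhds hlt)] with n hn
    have hs : MeasurableSet {ω | N < Xs n ω} := measurableSet_lt measurable_const (hXs n)
    calc genMoment (μs n) α (Xs n) x l
        ≤ ∫⁻ ω, (ENNReal.ofReal (min (f (Xs n ω)) (f N)) +
            {ω | N < Xs n ω}.indicator (fun ω => ENNReal.ofReal (f (Xs n ω))) ω) ∂(μs n) := by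
          refine lintegral_mono fun ω => ?_
          by_cases hω : N < Xs n ω
          · rw [Set.indicator_of_mem (show ω ∈ {ω | N < Xs n ω} from hω)]
            exact le_add_self
          · rw [min_eq_left (hmono (not_lt.1 hω))]
            exact le_self_add
      _ = ∫⁻ ω, ENNReal.ofReal (min (f (Xs n ω)) (f N)) ∂(μs n) +
            ∫⁻ ω in {ω | N < Xs n ω}, ENNReal.ofReal (f (Xs n ω)) ∂(μs n) := by
          rw [lintegral_add_left, lintegral_indicator hs]
          exact ((hcont.measurable.comp (hXs n)).min measurable_const).ennreal_ofReal
      _ < d + (c - d) := ENNReal.add_lt_add hn ((le_iSup (fun n => ∫⁻ ω in {ω | N < Xs n ω},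
            ENNReal.ofReal (f (Xs n ω)) ∂(μs n)) n).trans_lt hN)
      _ = c := add_tsub_cancel_of_le hdc.le
  · intro c hc
    rcases lt_or_ge (x : EReal) (xStar μ X) with hlt | hge
    · exact eventually_le_tailBound hX hXs h tendsto_const_nhds h0 tendsto_const_nhds
        (measure_lt_pos_of_lt_xStar hX hlt) (tailBound_le_one hX hα x) hc
    · rw [tailBound_eq_of_ae_le hX (ae_le_of_xStar_le hX hge)] at hc
      -- Here the limit is P(X = x). It is zero in the outer cases; in the middle one, P(X_n = x)
      -- bounds the tail bound of X_n from below.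
      rcases hx with hx | hx | hx
      · rw [measure_eq_zero_of_xStar_lt hX (lt_of_le_of_ne hge hx.symm)] at hc
        exact absurd hc not_lt_zero
      · filter_upwards [hx.eventually (lt_mem_nhds hc)] with n hn
        refine hn.le.trans (le_trans (measure_mono fun ω hω => ?_) (measure_le_tailBound (hXs n) x))
        exact (show Xs n ω = x from hω).ge
      · rw [hx] at hc
        exact absurd hc not_lt_zero

end StabilityInDistribution

theorem theorem1 {Ω : Type*} [MeasurableSpace Ω] (μ : Measure Ω) [IsProbabilityMeasure μ]
    (α : ℝ≥0∞) (X : Ω → ℝ) (hX : Measurable X) :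
    -- Model-independence
    (∀ (Ω' : Type*) [MeasurableSpace Ω'] (ν : Measure Ω') [IsProbabilityMeasure ν] (Y : Ω' → ℝ),
      Measurable Y → μ.map X = ν.map Y → ∀ x : ℝ, tailBound μ α X x = tailBound ν α Y x) ∧
    -- Monotonicity in `X`: dominance of order `α + 1`, of any order `β + 1 ∈ [1, α + 1]`,
    -- and almost sure domination
    (∀ (Ω' : Type*) [MeasurableSpace Ω'] (ν : Measure Ω') [IsProbabilityMeasure ν] (Y : Ω' → ℝ),
      Measurable Y → StochDom α μ X ν Y → ∀ x : ℝ, tailBound μ α X x ≤ tailBound ν α Y x) ∧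
    (∀ (Ω' : Type*) [MeasurableSpace Ω'] (ν : Measure Ω') [IsProbabilityMeasure ν] (Y : Ω' → ℝ),
      Measurable Y → ∀ β ≤ α, StochDom β μ X ν Y →
        ∀ x : ℝ, tailBound μ α X x ≤ tailBound ν α Y x) ∧
    (∀ Y : Ω → ℝ, Measurable Y → (∀ᵐ ω ∂μ, X ω ≤ Y ω) →
      ∀ x : ℝ, tailBound μ α X x ≤ tailBound μ α Y x) ∧
    -- Monotonicity in `α`
    (∀ x : ℝ, Monotone (fun γ : ℝ≥0∞ => tailBound μ γ X x)) ∧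
    -- Monotonicity in `x`
    Antitone (fun x : ℝ => tailBound μ α X x) ∧
    -- Values in `[0, 1]`
    (HasTailMoment μ α X → ∀ x : ℝ, tailBound μ α X x ∈ Set.Icc (0 : ℝ≥0∞) 1) ∧
    -- `α`-concavity in `x`
    (HasTailMoment μ α X → α ≠ 0 → α ≠ ∞ →
      ConvexOn ℝ≥0 Set.univ (fun x : ℝ => (tailBound μ α X x) ^ (-1 / α.toReal))) ∧
    (HasTailMoment μ α X → α = ∞ →
      ∀ x y a b : ℝ, 0 ≤ a → 0 ≤ b → a + b = 1 →
        (a : EReal) * ENNReal.log (tailBound μ α X x)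
            + (b : EReal) * ENNReal.log (tailBound μ α X y)
          ≤ ENNReal.log (tailBound μ α X (a * x + b * y))) ∧
    -- Stability in `x`
    (HasTailMoment μ α X → α ≠ 0 → ∀ x : ℝ,
      (ContinuousAt (fun y : ℝ => tailBound μ α X y) x ↔
        ¬ ((x : EReal) = xStar μ X ∧ 0 < pStar μ X))) ∧
    -- Stability in `α`
    (∀ αs : ℕ → ℝ≥0, Tendsto (fun n => (αs n : ℝ≥0∞)) atTop (𝓝 α) →
      HasTailMoment μ (⨆ n, (αs n : ℝ≥0∞)) X →
      ∀ x : ℝ, Tendsto (fun n => tailBound μ (αs n : ℝ≥0∞) X x) atTop (𝓝 (tailBound μ α X x))) ∧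
    -- Stability in `X`
    (HasTailMoment μ α X → α ≠ 0 →
      ∀ (Ωs : ℕ → Type*) [∀ n, MeasurableSpace (Ωs n)] (μs : ∀ n, Measure (Ωs n))
        [∀ n, IsProbabilityMeasure (μs n)] (Xs : ∀ n, Ωs n → ℝ),
        (∀ n, Measurable (Xs n)) → TendstoInDistribution Xs atTop X μs μ →
        UnifIntTail α μs Xs μ X →
        ∀ x : ℝ,
          ((x : EReal) ≠ xStar μ X ∨
            Tendsto (fun n => μs n {ω | Xs n ω = x}) atTop (𝓝 (μ {ω | X ω = x})) ∨
            μ {ω | X ω = x} = 0) →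
          Tendsto (fun n => tailBound (μs n) α (Xs n) x) atTop (𝓝 (tailBound μ α X x))) ∧
    -- Translation invariance
    (∀ c x : ℝ, tailBound μ α (fun ω => X ω + c) (x + c) = tailBound μ α X x) ∧
    -- Consistency
    (∀ c x : ℝ,
      tailBound μ α (fun _ => c) x = tailBound μ 0 (fun _ => c) x ∧
      tailBound μ 0 (fun _ => c) x = (if x ≤ c then 1 else 0)) ∧
    -- Positive homogeneity
    (∀ κ : ℝ, 0 < κ → ∀ x : ℝ,
      tailBound μ α (fun ω => κ * X ω) (κ * x) = tailBound μ α X x) := by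
  refine ⟨fun _ _ _ _ _ hY h x => tailBound_congr_map hX hY h x,
    fun _ _ _ _ _ hY h x => h.tailBound_le hX hY le_rfl x,
    fun _ _ _ _ _ hY _ hβ h x => h.tailBound_le hX hY hβ x,
    fun _ _ h x => tailBound_mono_ae h x,
    tailBound_mono_left,
    tailBound_antitone,
    fun h x => ⟨zero_le, tailBound_le_one hX h x⟩,
    fun _ h0 h1 => convexOn_tailBound_rpow h0 h1,
    ?_,
    fun h h0 x => continuousAt_tailBound_iff hX h h0 x,
    fun _ hα h x => tendsto_tailBound_order hX hα h x,
    fun hα h0 _ _ _ _ _ hXs h hui x hx =>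
      tendsto_tailBound_of_tendstoInDistribution hX hXs hα h0 h hui hx,
    tailBound_add_const,
    fun c x => ⟨by rw [tailBound_const, tailBound_const], tailBound_const 0 c x⟩,
    fun κ hκ x => tailBound_const_mul hκ x⟩
  rintro - rfl x y a b ha hb hab
  exact log_tailBound_top_concave x y ha hb hab
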